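/- All graphs are finite, undirected and without multiple edges; loops are allowed. A graph is irreflexive if it has no loops, $N(v)$ denotes the set of neighbours of $v$ (so $v\in N(v)$ iff $v$ has a loop), and a graph is bipartite if its vertices can be coloured black and white so that adjacent vertices get different colours. The product $G\times H$ has vertex set $V(G)\times V(H)$, with $(g,h)\sim(g',h')$ iff $g\sim g'$ and $h\sim h'$; $H^k$ is the $k$-fold product. An NU (near-unanimity) polymorphism of $H$ is a homomorphism $f:H^k\to H$, for some $k\ge 3$, such that $f(x_1,\dots,x_k)=v$ whenever at least $k-1$ of the $x_i$ equal $v$; a graph is an NU graph if it admits one. The diagonal $\Delta(H^2)$ is the subgraph of $H^2$ induced on $\{(x,x):x\in V(H)\}$, and the diagonal component $C_\Delta(H^2)$ is the component of $H^2$ containing $\Delta(H^2)$. A graph $F$ dismantles to an induced subgraph $F'$ if $F'$ is obtained from $F$ by successively deleting finitely many (possibly no) vertices, each deleted vertex $v$ having $N(v)\subseteq N(v')$ for some vertex $v'\ne v$, where the neighbourhoods are taken in the graph that is present before the deletion. A partial $H$-colouring of $G$ is a map $p:S\to V(H)$ with $S\subseteq V(G)$. The graph $\mathrm{Hom}(G,H;p)$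 has as vertices the homomorphisms $G\to H$ that extend $p$, with $\varphi\sim\psi$ iff $\varphi(u)\sim\psi(v)$ for all $u\sim v$ in $G$. The graph $H$ is Ext-trivial if $\mathrm{Hom}(G,H;p)$ is connected (the empty graph counting as connected) for every connected graph $G$ and every partial $H$-colouring $p$ of $G$. The graph $H$ is bipartite Ext-trivial if it is bipartite and, for every bipartition of $H$ into black and white vertices, every connected bipartite graph $G$ with a bipartition into black and white vertices, and every colour-preserving partial $H$-colouring $p$ of $G$, the subgraph $\mathrm{Hom}_B(G,H;p)$ of $\mathrm{Hom}(G,H;p)$ induced on the colour-preserving homomorphisms is connected (or empty). **Theorem.** For a finite connected graph $H$ the following are equivalent: 1. $H$ admits an NU polymorphism; 2. $C_\Delta(H^2)$ dismantles to $\Delta(H^2)$; 3. $H$ is Ext-trivial or bipartite Ext-trivial. Consequently, a connected graph $H$ with at least one edge (a loop counts as an edge) is Ext-trivial if and only if it is an NU graph with a loop, and a connected irreflexive graph is bipartite Ext-trivial if and only if it is an NU graph. -/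

import Mathlib

universe u v

/-- An undirected graph on the vertex set `V` in which loops are allowed (and there are no
multiple edges): a symmetric adjacency relation. -/
structure LoopGraph (V : Type u) where
  Adj : V → V → Prop
  symm : ∀ x y, Adj x y → Adj y x

namespace LoopGraph

variable {U : Type v} {V : Type u}

/-- There is a walk from `x` to `y`. -/
def Reachable (G : LoopGraph V) (x y : V) : Prop :=
  Relation.ReflTransGen G.Adj x y

/-- Any two vertices are joined by a walk (the graph without vertices is allowed). -/
def Preconnected (G : LoopGraph V) : Prop :=
  ∀ x y, G.Reachable x y

/-- Any two vertices are joined by a walk, and there is a vertex. -/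
def Connected (G : LoopGraph V) : Prop :=
  Nonempty V ∧ G.Preconnected

/-- The subgraph induced on a set of vertices. -/
def induce (G : LoopGraph V) (S : Set V) : LoopGraph S where
  Adj x y := G.Adj x y
  symm x y h := G.symm x y h

/-- The categorical product `G × H`. -/
def prod (G : LoopGraph U) (H : LoopGraph V) : LoopGraph (U × V) where
  Adj x y := G.Adj x.1 y.1 ∧ H.Adj x.2 y.2
  symm _ _ h := ⟨G.symm _ _ h.1, H.symm _ _ h.2⟩

/-- The `k`-th categorical power `H ^ k`. -/
def power (H : LoopGraph V) (k : ℕ) : LoopGraph (Fin k → V) where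
  Adj x y := ∀ i, H.Adj (x i) (y i)
  symm _ _ h := fun i => H.symm _ _ (h i)

/-- Graph homomorphisms: adjacency-preserving maps. -/
abbrev Hom (G : LoopGraph U) (H : LoopGraph V) : Type (max u v) :=
  G.Adj →r H.Adj

/-! ### Near unanimity polymorphisms -/

/-- A `k`-ary map is near unanimity if `k ≥ 3` and it takes the value `a` whenever
all its arguments, with the exception of at most one, are equal to `a`. -/
def IsNearUnanimity {k : ℕ} (f : (Fin k → V) → V) : Prop :=
  3 ≤ k ∧ ∀ (x : Fin k → V) (a : V) (j : Fin k), (∀ i, i ≠ j → x i = a) → f x = a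

/-- `H` is an NU graph: for some `k` there is a homomorphism `H ^ k → H` that is near
unanimity. -/
def HasNUPolymorphism (H : LoopGraph V) : Prop :=
  ∃ (k : ℕ) (f : Hom (H.power k) H), IsNearUnanimity (fun x => f x)

/-! ### Dismantling

Induced subgraphs of a fixed graph `G` are represented by their vertex sets. -/

/-- In the subgraph of `G` induced on `S`, the vertex `b` dominates the vertex `a`:
`N(a) ⊆ N(b)`. -/
def Dominates (G : LoopGraph V) (S : Set V) (b a : V) : Prop :=
  a ∈ S ∧ b ∈ S ∧ ∀ w ∈ S, G.Adj a w → G.Adj b w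

/-- One dismantling retraction: from the subgraph induced on `S`, a vertex that is dominated
by another vertex is removed (it is mapped to that other vertex). -/
def DismantleStep (G : LoopGraph V) (S T : Set V) : Prop :=
  ∃ a b, b ≠ a ∧ G.Dominates S b a ∧ T = S \ {a}

/-- The subgraph of `G` induced on `S` dismantles to the subgraph induced on `T`, by a finite
(possibly empty) sequence of dismantling retractions. -/
def Dismantles (G : LoopGraph V) (S T : Set V) : Prop :=
  Relation.ReflTransGen G.DismantleStep S T

/-- The vertex set of the diagonal `Δ(H²)`. -/
def diagonal (V : Type u) : Set (V × V) :=
  {x | x.1 = x.2}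

/-- The vertex set of the diagonal component `C_Δ(H²)`: the vertices of `H × H` that are
joined by a walk to a vertex of the diagonal. -/
def diagonalComponent (H : LoopGraph V) : Set (V × V) :=
  {x | ∃ d ∈ diagonal V, (H.prod H).Reachable d x}

/-! ### Hom-graphs and Ext-triviality -/

/-- The Hom-graph: its vertices are the homomorphisms from `G` to `H`, and `φ` is adjacent to
`ψ` if `φ x` is adjacent to `ψ y` whenever `x` is adjacent to `y`. -/
def homGraph (G : LoopGraph U) (H : LoopGraph V) : LoopGraph (Hom G H) where
  Adj φ ψ := ∀ x y, G.Adj x y → H.Adj (φ x) (ψ y)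
  symm _ _ h := fun x y hxy => H.symm _ _ (h y x (G.symm x y hxy))

/-- The homomorphisms from `G` to `H` that extend the partial `H`-colouring `p : S → V(H)`. -/
def extensions (G : LoopGraph U) (H : LoopGraph V) {S : Set U} (p : S → V) :
    Set (Hom G H) :=
  {φ | ∀ s : S, φ s = p s}

/-- The relative Hom-graph `Hom(G, H; p)`. -/
def relHomGraph (G : LoopGraph U) (H : LoopGraph V) {S : Set U} (p : S → V) :
    LoopGraph (extensions G H p) :=
  (homGraph G H).induce (extensions G H p)

/-- `H` is Ext-trivial: `Hom(G, H; p)` is connected, or empty, for every finite connected graph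
`G` and every partial `H`-colouring `p` of `G`. -/
def ExtTrivial (H : LoopGraph V) : Prop :=
  ∀ (U : Type u) [Finite U] (G : LoopGraph U), G.Connected →
    ∀ (S : Set U) (p : S → V), (relHomGraph G H p).Preconnected

/-- `c` is a bipartition of `G` into black (`true`) and white (`false`) vertices. -/
def IsBipartition (G : LoopGraph V) (c : V → Bool) : Prop :=
  ∀ x y, G.Adj x y → c x ≠ c y

/-- The extensions of `p` that preserve the colours of the given bipartitions. -/
def colouredExtensions (G : LoopGraph U) (H : LoopGraph V) (cG : U → Bool) (cH : V → Bool)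
    {S : Set U} (p : S → V) : Set (Hom G H) :=
  {φ | φ ∈ extensions G H p ∧ ∀ x, cH (φ x) = cG x}

/-- The graph `Hom_B(G, H; p)`. -/
def relHomGraphB (G : LoopGraph U) (H : LoopGraph V) (cG : U → Bool) (cH : V → Bool)
    {S : Set U} (p : S → V) : LoopGraph (colouredExtensions G H cG cH p) :=
  (homGraph G H).induce (colouredExtensions G H cG cH p)

/-- `H` is bipartite Ext-trivial: it is bipartite, and for each of its bipartitions, for every
finite connected graph `G` with a bipartition, and for every colour-preserving partial
`H`-colouring `p` of `G`, the graph `Hom_B(G, H; p)` is connected, or empty. -/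
def BipartiteExtTrivial (H : LoopGraph V) : Prop :=
  (∃ cH : V → Bool, H.IsBipartition cH) ∧
  ∀ cH : V → Bool, H.IsBipartition cH →
    ∀ (U : Type u) [Finite U] (G : LoopGraph U), G.Connected →
      ∀ cG : U → Bool, G.IsBipartition cG →
        ∀ (S : Set U) (p : S → V), (∀ s : S, cH (p s) = cG s) →
          (relHomGraphB G H cG cH p).Preconnected

end LoopGraph

/-!
Let `H` be a finite connected graph with more than one vertex. All conditions are equivalent to the
existence of an *interpolation* (`IsInterpolation`): a sequence of idempotent maps `F 0, …, F m`
from the diagonal component of `H²` to `H`, from the first projection to the second, in which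
consecutive maps are adjacent homomorphisms. Membership in the diagonal component means being
joined by a walk of even length (`EvenReachable`).

* Dismantling. Removing dominated vertices gives a deformation of the diagonal component onto the
  diagonal; following one coordinate forwards and the other one backwards yields an interpolation.
  Conversely, the first map in a deformation that moves a vertex exhibits a dominated vertex
  (`IsDeformation.dismantles`).
* Ext-triviality. Two extensions of a partial colouring are joined by the path `F i (φ u) (ψ u)`,
  as soon as all pairs `φ u`, `ψ u` are joined by even walks. Conversely an interpolation is a path
  between the two projections in a relative Hom-graph of the diagonal component.
* From near unanimity to interpolation. `H` dismantles to a stiff retract, in which no vertex is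
  dominated. Nesting the operation makes it ignore as many deviating arguments as there are
  vertices; a pursuit argument (`eq_of_pursuit`) then shows that on the stiff retract it ignores all
  arguments of the parity class, so that even walks there are closed. This gives a homotopy between
  the two projections, and applying the near unanimity operation to suitably delayed copies of it
  makes it idempotent.
* From interpolation to near unanimity. A near unanimity operation of arity `k` is a list
  homomorphism from `H ^ k` to `H`. For large `k`, a bounded number of rounds of arc consistency
  leaves all lists nonempty (`card_removed_le`), so trees of bounded depth have solutions. A finite
  regular cover of `H ^ k` looks locally like a tree, and local solutions can be glued with the
  interpolation (`exists_isSolOn_of_local`). Finally the graph of all solutions on the cover is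
  contractible, so it has a clique that is invariant under the deck transformations
  (`exists_invariant_clique`), and a member of that clique descends to `H ^ k`.

An Ext-trivial graph with an edge has a loop because the ends of the edge are joined by an even
walk, which a deformation onto the stiff retract contracts.
-/

namespace LoopGraph

variable {U : Type v} {V : Type u} {G : LoopGraph U} {H : LoopGraph V}

/-! ### Walks of even length -/

/-- There is a walk of even length from `x` to `y`. -/
def EvenReachable (H : LoopGraph V) (x y : V) : Prop :=
  Relation.ReflTransGen (Relation.Comp H.Adj H.Adj) x y

namespace EvenReachable

theorem refl (x : V) : H.EvenReachable x x := Relation.ReflTransGen.refl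

theorem trans {x y z : V} (h : H.EvenReachable x y) (h' : H.EvenReachable y z) :
    H.EvenReachable x z := Relation.ReflTransGen.trans h h'

theorem of_common {x y z : V} (h : H.Adj z x) (h' : H.Adj z y) : H.EvenReachable x y :=
  Relation.ReflTransGen.single ⟨z, H.symm _ _ h, h'⟩

theorem symm {x y : V} (h : H.EvenReachable x y) : H.EvenReachable y x := by
  induction h with
  | refl => exact refl _
  | tail _ hs ih =>
    obtain ⟨c, h1, h2⟩ := hs
    exact trans (of_common h2 (H.symm _ _ h1)) ih

/-- Both ends of an even walk can be moved along an edge. -/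
theorem step {x y x' y' : V} (h : H.EvenReachable x y) (hx : H.Adj x x') (hy : H.Adj y y') :
    H.EvenReachable x' y' := by
  induction h generalizing y' with
  | refl => exact of_common hx hy
  | tail _ hs ih =>
    obtain ⟨c, h1, h2⟩ := hs
    exact trans (ih h1) (of_common (H.symm _ _ h2) hy)

theorem map {W : Type*} {K : LoopGraph W} (f : V → W)
    (hf : ∀ x y, H.Adj x y → K.Adj (f x) (f y)) {x y : V} (h : H.EvenReachable x y) :
    K.EvenReachable (f x) (f y) := by
  induction h with
  | refl => exact refl _
  | tail _ hs ih =>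
    obtain ⟨c, h1, h2⟩ := hs
    exact trans ih (of_common (K.symm _ _ (hf _ _ h1)) (hf _ _ h2))

end EvenReachable

theorem exists_adj_of_connected [Nontrivial V] (hH : H.Connected) (x : V) : ∃ y, H.Adj x y := by
  obtain ⟨y, hy⟩ := exists_ne x
  rcases Relation.ReflTransGen.cases_head (hH.2 x y) with h | ⟨z, hz, _⟩
  · exact absurd h.symm hy
  · exact ⟨z, hz⟩

theorem mem_diagonalComponent_iff (hN : ∀ x, ∃ y, H.Adj x y) {x y : V} :
    (x, y) ∈ H.diagonalComponent ↔ H.EvenReachable x y := by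
  constructor
  · rintro ⟨d, hd, h⟩
    suffices ∀ z, (H.prod H).Reachable d z → H.EvenReachable z.1 z.2 from this _ h
    intro z hz
    induction hz with
    | refl => rw [show d.1 = d.2 from hd]; exact .refl _
    | tail _ hs ih => exact ih.step hs.1 hs.2
  · intro h
    induction h with
    | refl => exact ⟨(x, x), rfl, Relation.ReflTransGen.refl⟩
    | tail _ hs ih =>
      obtain ⟨c, h1, h2⟩ := hs
      obtain ⟨d, hd, h⟩ := ih
      obtain ⟨x', hx'⟩ := hN x
      exact ⟨d, hd, (h.tail (show (H.prod H).Adj _ (x', c) from ⟨hx', h1⟩)).tail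
        ⟨H.symm _ _ hx', h2⟩⟩

theorem Reachable.even_or_odd {x y : V} (h : H.Reachable x y) :
    H.EvenReachable x y ∨ ∃ x', H.Adj x x' ∧ H.EvenReachable x' y := by
  induction h with
  | refl => exact .inl (.refl _)
  | tail _ hs ih =>
    rcases ih with h | ⟨x', hx, h⟩
    · rcases Relation.ReflTransGen.cases_head h with rfl | ⟨c, ⟨b, h1, h2⟩, h3⟩
      · exact .inr ⟨_, hs, .refl _⟩
      · exact .inr ⟨b, h1, EvenReachable.step h h1 hs⟩
    · exact .inl (h.step (H.symm _ _ hx) hs)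

/-- In a connected graph, being joined by an even walk has at most two classes. -/
theorem evenReachable_of_not (hH : H.Connected) {x y z : V} (hxy : ¬ H.EvenReachable x y)
    (hyz : ¬ H.EvenReachable y z) : H.EvenReachable x z := by
  rcases (hH.2 y x).even_or_odd with h | ⟨a, ha, h⟩
  · exact absurd h.symm hxy
  rcases (hH.2 y z).even_or_odd with h' | ⟨b, hb, h'⟩
  · exact absurd h' hyz
  exact (h.symm.trans (.of_common ha hb)).trans h'

theorem IsBipartition.eq_of_evenReachable {c : V → Bool} (hc : H.IsBipartition c) {x y : V}
    (h : H.EvenReachable x y) : c x = c y := by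
  induction h with
  | refl => rfl
  | tail _ hs ih =>
    obtain ⟨b, h1, h2⟩ := hs
    rw [ih, Bool.eq_not.2 (hc _ _ h1), Bool.eq_not.2 (hc _ _ h2), Bool.not_not]

theorem IsBipartition.evenReachable_of_eq (hH : H.Connected) {c : V → Bool}
    (hc : H.IsBipartition c) {x y : V} (h : c x = c y) : H.EvenReachable x y := by
  rcases (hH.2 x y).even_or_odd with h' | ⟨a, ha, h'⟩
  · exact h'
  · exact absurd (h.trans (hc.eq_of_evenReachable h').symm) (hc _ _ ha)

open Classical in
theorem evenReachable_of_not_bipartite (hH : H.Connected) (hb : ¬ ∃ c, H.IsBipartition c)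
    (x y : V) : H.EvenReachable x y := by
  by_contra hxy
  apply hb
  refine ⟨fun v => decide (H.EvenReachable x v), fun v w hvw heq => ?_⟩
  have heq : H.EvenReachable x v ↔ H.EvenReachable x w := by simpa using heq
  -- an edge inside a class is an odd closed walk, which makes every pair even
  have hv : H.EvenReachable v w := by
    by_cases h : H.EvenReachable x v
    · exact h.symm.trans (heq.1 h)
    · exact evenReachable_of_not hH (fun h' => h h'.symm) (fun h' => h (heq.2 h'))
  have key : ∀ z, H.Reachable v z → ∃ z', H.Adj z z' ∧ H.EvenReachable z z' := by
    intro z hz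
    induction hz with
    | refl => exact ⟨w, hvw, hv⟩
    | tail _ hs ih =>
      obtain ⟨z', h1, h2⟩ := ih
      exact ⟨_, H.symm _ _ hs, h2.step hs (H.symm _ _ h1)⟩
  obtain ⟨x', h1, h2⟩ := key x (hH.2 v x)
  rcases (hH.2 x y).even_or_odd with h' | ⟨a, ha, h'⟩
  · exact hxy h'
  · exact hxy ((h2.trans (.of_common h1 ha)).trans h')

/-! ### Homotopies and interpolations -/

/-- A sequence of maps `F i`, defined on the pairs joined by an even walk, that starts with the
first projection and becomes the second one, such that any two consecutive maps are adjacent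
homomorphisms. -/
structure IsPairHomotopy (H : LoopGraph V) (m : ℕ) (F : ℕ → V → V → V) : Prop where
  zero : ∀ {x y}, H.EvenReachable x y → F 0 x y = x
  last : ∀ {i}, m ≤ i → ∀ {x y}, H.EvenReachable x y → F i x y = y
  adj : ∀ i {x y x' y'}, H.EvenReachable x y → H.Adj x x' → H.Adj y y' →
    H.Adj (F i x y) (F i x' y')
  adj_succ : ∀ i {x y x' y'}, H.EvenReachable x y → H.Adj x x' → H.Adj y y' →
    H.Adj (F i x y) (F (i + 1) x' y')

/-- A homotopy from the first to the second projection that fixes the diagonal. -/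
structure IsInterpolation (H : LoopGraph V) (m : ℕ) (F : ℕ → V → V → V) : Prop
    extends IsPairHomotopy H m F where
  diag : ∀ i x, F i x x = x

theorem IsPairHomotopy.adj_of_le {m : ℕ} {F : ℕ → V → V → V} (h : IsPairHomotopy H m F)
    {i j : ℕ} (hij : i ≤ j + 1) (hji : j ≤ i + 1) {x y x' y' : V} (he : H.EvenReachable x y)
    (hx : H.Adj x x') (hy : H.Adj y y') : H.Adj (F i x y) (F j x' y') := by
  obtain rfl | rfl | rfl : i = j ∨ j = i + 1 ∨ i = j + 1 := by omega
  · exact h.adj _ he hx hy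
  · exact h.adj_succ _ he hx hy
  · exact H.symm _ _ (h.adj_succ _ (he.step hx hy) (H.symm _ _ hx) (H.symm _ _ hy))

theorem IsPairHomotopy.evenReachable {m : ℕ} {F : ℕ → V → V → V} (h : IsPairHomotopy H m F)
    (hN : ∀ x, ∃ y, H.Adj x y) (i : ℕ) {x y : V} (he : H.EvenReachable x y) :
    H.EvenReachable x (F i x y) := by
  induction i generalizing x y with
  | zero => rw [h.zero he]; exact .refl _
  | succ i ih =>
    obtain ⟨x', hx⟩ := hN x
    obtain ⟨y', hy⟩ := hN y
    have he' := he.step hx hy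
    exact (ih he').step (H.symm _ _ hx) (h.adj_succ i he' (H.symm _ _ hx) (H.symm _ _ hy))

/-- A deformation of `S` within itself, through pairwise adjacent consecutive homomorphisms,
that starts with the identity, fixes `T` throughout, and ends in `T`. -/
structure IsDeformation (K : LoopGraph V) (S T : Set V) (m : ℕ) (r : ℕ → V → V) : Prop where
  zero : ∀ {x}, x ∈ S → r 0 x = x
  mem : ∀ i {x}, x ∈ S → r i x ∈ S
  fix : ∀ i {x}, x ∈ T → r i x = x
  last : ∀ {i}, m ≤ i → ∀ {x}, x ∈ S → r i x ∈ T
  adj : ∀ i {x y}, x ∈ S → y ∈ S → K.Adj x y → K.Adj (r i x) (r i y)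
  adj_succ : ∀ i {x y}, x ∈ S → y ∈ S → K.Adj x y → K.Adj (r i x) (r (i + 1) y)

theorem DismantleStep.subset {S T : Set V} (h : H.DismantleStep S T) : T ⊆ S := by
  obtain ⟨a, b, _, _, rfl⟩ := h
  exact Set.sdiff_subset

theorem Dismantles.subset {S T : Set V} (h : H.Dismantles S T) : T ⊆ S := by
  induction h with
  | refl => exact subset_rfl
  | tail _ hs ih => exact hs.subset.trans ih

open Classical in
theorem Dominates.adj_fold {S : Set V} {a b : V} (hd : H.Dominates S b a) {x y : V} (hx : x ∈ S)
    (hxy : H.Adj x y) : H.Adj x (if y = a then b else y) := by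
  split_ifs with h
  · subst h
    exact H.symm _ _ (hd.2.2 _ hx (H.symm _ _ hxy))
  · exact hxy

open Classical in
theorem Dismantles.exists_isDeformation {S T : Set V} (h : H.Dismantles S T) :
    ∃ m r, IsDeformation H S T m r := by
  induction h using Relation.ReflTransGen.head_induction_on with
  | refl =>
    exact ⟨0, fun _ x => x, fun _ => rfl, fun _ _ h => h, fun _ _ _ => rfl, fun _ _ h => h,
      fun _ _ _ _ _ h => h, fun _ _ _ _ _ h => h⟩
  | @head S S' hs hd ih =>
    obtain ⟨m, r, hr⟩ := ih
    have hT : T ⊆ S' := Dismantles.subset hd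
    obtain ⟨a, b, hba, hdom, rfl⟩ := hs
    have hρ : ∀ {x}, x ∈ S → (if x = a then b else x) ∈ S \ {a} := by
      intro x hx
      split_ifs with h
      · exact ⟨hdom.2.1, hba⟩
      · exact ⟨hx, h⟩
    have hadj : ∀ {x y}, x ∈ S → y ∈ S → H.Adj x y →
        H.Adj (if x = a then b else x) (if y = a then b else y) := by
      intro x y hx hy hxy
      exact hdom.adj_fold (hρ hx).1
        (H.symm _ _ (hdom.adj_fold hy (H.symm _ _ hxy)))
    refine ⟨m + 1, fun i x => Nat.casesOn i x (fun i => r i (if x = a then b else x)),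
      ⟨fun _ => rfl, ?_, ?_, ?_, ?_, ?_⟩⟩
    · rintro (_ | i) x hx
      · exact hx
      · exact (hr.mem i (hρ hx)).1
    · rintro (_ | i) x hx
      · rfl
      · have : x ≠ a := (hT hx).2
        simpa [this] using hr.fix i hx
    · rintro (_ | i) hi x hx
      · omega
      · exact hr.last (by omega) (hρ hx)
    · rintro (_ | i) x y hx hy hxy
      · exact hxy
      · exact hr.adj i (hρ hx) (hρ hy) (hadj hx hy hxy)
    · rintro (_ | i) x y hx hy hxy
      · show H.Adj x (r 0 _)
        rw [hr.zero (hρ hy)]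
        exact hdom.adj_fold hx hxy
      · exact hr.adj_succ i (hρ hx) (hρ hy) (hadj hx hy hxy)

open Classical in
theorem IsDeformation.dismantles [Finite V] {S T : Set V} (hTS : T ⊆ S) {m : ℕ} {r : ℕ → V → V}
    (hr : IsDeformation H S T m r) : H.Dismantles S T := by
  induction hn : S.ncard using Nat.strong_induction_on generalizing S r with
  | _ n ih =>
  subst hn
  by_cases hST : S ⊆ T
  · rw [hTS.antisymm hST]; exact Relation.ReflTransGen.refl
  obtain ⟨z, hzS, hzT⟩ := Set.not_subset.1 hST
  have hex : ∃ i, ∃ x ∈ S, r i x ≠ x :=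
    ⟨m, z, hzS, fun h => hzT (h ▸ hr.last le_rfl hzS)⟩
  -- the first map that moves a vertex exhibits a dominated vertex
  obtain ⟨a, haS, ha⟩ := Nat.find_spec hex
  obtain ⟨i, hi⟩ : ∃ i, Nat.find hex = i + 1 := by
    refine Nat.exists_eq_succ_of_ne_zero fun h0 => ha ?_
    rw [h0]; exact hr.zero haS
  have hid : ∀ x ∈ S, r i x = x := by
    intro x hx
    by_contra h
    exact Nat.find_min hex (m := i) (by omega) ⟨x, hx, h⟩
  rw [hi] at ha
  set b := r (i + 1) a with hb
  have hdom : H.Dominates S b a := by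
    refine ⟨haS, hr.mem _ haS, fun w hw haw => ?_⟩
    have := hr.adj_succ i hw haS (H.symm _ _ haw)
    rw [hid w hw] at this
    exact H.symm _ _ this
  have haT : a ∉ T := fun h => ha (hr.fix _ h)
  have hstep : H.DismantleStep S (S \ {a}) := ⟨a, b, ha, hdom, rfl⟩
  have hρ : ∀ {x}, x ∈ S → (if x = a then b else x) ∈ S \ {a} := by
    intro x hx
    split_ifs with h
    · exact ⟨hdom.2.1, ha⟩
    · exact ⟨hx, h⟩
  have hadj : ∀ {x y}, x ∈ S → y ∈ S → H.Adj x y →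
      H.Adj (if x = a then b else x) (if y = a then b else y) := by
    intro x y hx hy hxy
    exact hdom.adj_fold (hρ hx).1
      (H.symm _ _ (hdom.adj_fold hy (H.symm _ _ hxy)))
  refine Relation.ReflTransGen.head hstep (ih (S \ {a}).ncard ?_
    (r := fun i x => if r i x = a then b else r i x)
    (fun x hx => ⟨hTS hx, fun h : x = a => haT (h ▸ hx)⟩) ?_ rfl)
  · exact Set.ncard_lt_ncard ⟨Set.sdiff_subset, fun h => (h haS).2 rfl⟩ (Set.toFinite _)
  · refine ⟨?_, ?_, ?_, ?_, ?_, ?_⟩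
    · rintro x ⟨hx, hxa⟩
      simp only [hr.zero hx]
      exact if_neg hxa
    · rintro i x ⟨hx, -⟩
      exact hρ (hr.mem i hx)
    · intro i x hx
      simp only [hr.fix i hx]
      exact if_neg fun h : x = a => haT (h ▸ hx)
    · rintro i hi x ⟨hx, -⟩
      have h := hr.last hi hx
      have h' : r i x ≠ a := fun e => haT (e ▸ h)
      simpa only [h', if_false] using h
    · rintro i x y ⟨hx, -⟩ ⟨hy, -⟩ hxy
      exact hadj (hr.mem i hx) (hr.mem i hy) (hr.adj i hx hy hxy)
    · rintro i x y ⟨hx, -⟩ ⟨hy, -⟩ hxy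
      exact hadj (hr.mem i hx) (hr.mem _ hy) (hr.adj_succ i hx hy hxy)

/-- If the pairs joined by even walks can be moved, through consecutive adjacent homomorphisms,
until both coordinates agree, then following the first coordinate forwards and the second one
backwards leads from the first projection to the second. -/
theorem exists_isPairHomotopy {m : ℕ} {p q : ℕ → V → V → V}
    (hp0 : ∀ {x y}, H.EvenReachable x y → p 0 x y = x)
    (hq0 : ∀ {x y}, H.EvenReachable x y → q 0 x y = y)
    (hm : ∀ {x y}, H.EvenReachable x y → p m x y = q m x y)
    (hp : ∀ i {x y x' y'}, H.EvenReachable x y → H.Adj x x' → H.Adj y y' →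
      H.Adj (p i x y) (p i x' y') ∧ H.Adj (p i x y) (p (i + 1) x' y'))
    (hq : ∀ i {x y x' y'}, H.EvenReachable x y → H.Adj x x' → H.Adj y y' →
      H.Adj (q i x y) (q i x' y') ∧ H.Adj (q i x y) (q (i + 1) x' y')) :
    IsPairHomotopy H (2 * m) (fun i x y => if i ≤ m then p i x y else q (2 * m - i) x y) := by
  have hqs : ∀ i {x y x' y'}, H.EvenReachable x y → H.Adj x x' → H.Adj y y' →
      H.Adj (q i x y) (q (i - 1) x' y') := by
    rintro (_ | i) x y x' y' he hx hy
    · exact (hq 0 he hx hy).1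
    · exact H.symm _ _ (hq i (he.step hx hy) (H.symm _ _ hx) (H.symm _ _ hy)).2
  refine ⟨?_, ?_, ?_, ?_⟩
  · intro x y he
    simpa using hp0 he
  · intro i hi x y he
    by_cases h : i ≤ m
    · obtain rfl : m = 0 := by omega
      obtain rfl : i = 0 := by omega
      simpa [hm he] using hq0 he
    · simp only [h, if_false, show 2 * m - i = 0 by omega]
      exact hq0 he
  · intro i x y x' y' he hx hy
    by_cases h : i ≤ m
    · simpa only [h, if_true] using (hp i he hx hy).1
    · simpa only [h, if_false] using (hq _ he hx hy).1
  · intro i x y x' y' he hx hy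
    rcases lt_trichotomy i m with h | rfl | h
    · simpa only [h.le, show i + 1 ≤ m from h, if_true] using (hp i he hx hy).2
    · simp only [le_refl, if_true, show ¬ i + 1 ≤ i by omega, if_false]
      rw [hm he, show 2 * i - (i + 1) = i - 1 by omega]
      exact hqs i he hx hy
    · simp only [show ¬ i ≤ m by omega, show ¬ i + 1 ≤ m by omega, if_false]
      rw [show 2 * m - (i + 1) = 2 * m - i - 1 by omega]
      exact hqs _ he hx hy

theorem exists_isInterpolation_of_dismantles (hN : ∀ x, ∃ y, H.Adj x y)
    (h : (H.prod H).Dismantles H.diagonalComponent (diagonal V)) :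
    ∃ m F, IsInterpolation H m F := by
  obtain ⟨m, r, hr⟩ := h.exists_isDeformation
  have hmem : ∀ {x y}, H.EvenReachable x y → (x, y) ∈ H.diagonalComponent :=
    fun h => (mem_diagonalComponent_iff hN).2 h
  have hadj : ∀ i {x y x' y'}, H.EvenReachable x y → H.Adj x x' → H.Adj y y' →
      (H.prod H).Adj (r i (x, y)) (r i (x', y')) ∧
      (H.prod H).Adj (r i (x, y)) (r (i + 1) (x', y')) := fun i x y x' y' he hx hy =>
    have hxy : (H.prod H).Adj (x, y) (x', y') := ⟨hx, hy⟩
    ⟨hr.adj i (hmem he) (hmem (he.step hx hy)) hxy,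
      hr.adj_succ i (hmem he) (hmem (he.step hx hy)) hxy⟩
  refine ⟨_, _, exists_isPairHomotopy (m := m) (p := fun i x y => (r i (x, y)).1)
    (q := fun i x y => (r i (x, y)).2) (fun he => by rw [hr.zero (hmem he)])
    (fun he => by rw [hr.zero (hmem he)]) (fun he => hr.last le_rfl (hmem he))
    (fun i _ _ _ _ he hx hy => ⟨(hadj i he hx hy).1.1, (hadj i he hx hy).2.1⟩)
    (fun i _ _ _ _ he hx hy => ⟨(hadj i he hx hy).1.2, (hadj i he hx hy).2.2⟩), ?_⟩
  intro i x
  have : ∀ j, r j (x, x) = (x, x) := fun j => hr.fix j rfl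
  simp [this]

theorem IsInterpolation.dismantles [Finite V] (hN : ∀ x, ∃ y, H.Adj x y) {m : ℕ}
    {F : ℕ → V → V → V} (hF : IsInterpolation H m F) :
    (H.prod H).Dismantles H.diagonalComponent (diagonal V) := by
  have hmem : ∀ {z : V × V}, z ∈ H.diagonalComponent ↔ H.EvenReachable z.1 z.2 :=
    mem_diagonalComponent_iff hN
  refine IsDeformation.dismantles (m := m) (r := fun i z => (F i z.1 z.2, z.2)) ?_
    ⟨?_, ?_, ?_, ?_, ?_, ?_⟩
  · exact fun z hz => ⟨z, hz, Relation.ReflTransGen.refl⟩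
  · intro z hz
    simp [hF.zero (hmem.1 hz)]
  · intro i z hz
    rw [hmem] at hz ⊢
    exact (hF.evenReachable hN i hz).symm.trans hz
  · rintro i ⟨x, y⟩ (rfl : x = y)
    simp [hF.diag]
  · intro i hi z hz
    exact hF.last hi (hmem.1 hz)
  · intro i z w hz _ h
    exact ⟨hF.adj i (hmem.1 hz) h.1 h.2, h.2⟩
  · intro i z w hz _ h
    exact ⟨hF.adj_succ i (hmem.1 hz) h.1 h.2, h.2⟩

/-! ### Ext-triviality and interpolations -/

/-- The homomorphism obtained by interpolating between `φ` and `ψ` at time `i`. -/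
def IsInterpolation.hom {m : ℕ} {F : ℕ → V → V → V} (hF : IsInterpolation H m F)
    {G : LoopGraph U} (φ ψ : Hom G H) (he : ∀ u, H.EvenReachable (φ u) (ψ u)) (i : ℕ) :
    Hom G H where
  toFun u := F i (φ u) (ψ u)
  map_rel' h := hF.adj i (he _) (φ.map_rel h) (ψ.map_rel h)

theorem IsInterpolation.reachable {m : ℕ} {F : ℕ → V → V → V} (hF : IsInterpolation H m F)
    {G : LoopGraph U} {E : Set (Hom G H)} (φ ψ : E) (he : ∀ u, H.EvenReachable (φ.1 u) (ψ.1 u))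
    (hE : ∀ i, hF.hom φ.1 ψ.1 he i ∈ E) : ((homGraph G H).induce E).Reachable φ ψ := by
  have h0 : (⟨_, hE 0⟩ : E) = φ := Subtype.ext (RelHom.ext fun u => hF.zero (he u))
  have hm : (⟨_, hE m⟩ : E) = ψ := Subtype.ext (RelHom.ext fun u => hF.last le_rfl (he u))
  have : ∀ i, ((homGraph G H).induce E).Reachable φ ⟨_, hE i⟩ := by
    intro i
    induction i with
    | zero => rw [h0]; exact Relation.ReflTransGen.refl
    | succ i ih =>
      refine ih.tail fun x y hxy => ?_
      exact hF.adj_succ i (he x) (φ.1.map_rel hxy) (ψ.1.map_rel hxy)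
  rw [← hm]
  exact this m

theorem IsInterpolation.extTrivial_or (hH : H.Connected) (hN : ∀ x, ∃ y, H.Adj x y) {m : ℕ}
    {F : ℕ → V → V → V} (hF : IsInterpolation H m F) :
    H.ExtTrivial ∨ H.BipartiteExtTrivial := by
  by_cases hb : ∃ c, H.IsBipartition c
  · refine .inr ⟨hb, fun c hc U _ G _ cG _ S p _ φ ψ => ?_⟩
    have he : ∀ u, H.EvenReachable (φ.1 u) (ψ.1 u) := fun u =>
      hc.evenReachable_of_eq hH ((φ.2.2 u).trans (ψ.2.2 u).symm)
    refine hF.reachable φ ψ he fun i => ⟨fun s => ?_, fun u => ?_⟩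
    · show F i (φ.1 s) (ψ.1 s) = p s
      rw [φ.2.1 s, ψ.2.1 s, hF.diag]
    · exact (hc.eq_of_evenReachable (hF.evenReachable hN i (he u))).symm.trans (φ.2.2 u)
  · refine .inl fun U _ G _ S p φ ψ => ?_
    refine hF.reachable φ ψ (fun u => evenReachable_of_not_bipartite hH hb _ _)
      fun i s => ?_
    show F i (φ.1 s) (ψ.1 s) = p s
    rw [φ.2 s, ψ.2 s, hF.diag]

theorem exists_sequence_of_reflTransGen {X : Type*} {R : X → X → Prop} (hR : ∀ x, R x x)
    {a b : X} (h : Relation.ReflTransGen R a b) :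
    ∃ (m : ℕ) (s : ℕ → X), s 0 = a ∧ (∀ i, m ≤ i → s i = b) ∧ ∀ i, R (s i) (s (i + 1)) := by
  induction h using Relation.ReflTransGen.head_induction_on with
  | refl => exact ⟨0, fun _ => b, rfl, fun _ _ => rfl, fun _ => hR b⟩
  | @head a c hac _ ih =>
    obtain ⟨m, s, h0, hm, hs⟩ := ih
    refine ⟨m + 1, fun i => Nat.casesOn i a s, rfl, ?_, ?_⟩
    · rintro (_ | i) hi
      · omega
      · exact hm i (by omega)
    · rintro (_ | i)
      · show R a (s 0)
        rwa [h0]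
      · exact hs i

/-- The diagonal component as a graph. -/
abbrev diagonalGraph (H : LoopGraph V) : LoopGraph H.diagonalComponent :=
  (H.prod H).induce H.diagonalComponent

/-- The first projection on the diagonal component. -/
def diagonalFst (H : LoopGraph V) : Hom H.diagonalGraph H where
  toFun z := z.1.1
  map_rel' h := h.1

/-- The second projection on the diagonal component. -/
def diagonalSnd (H : LoopGraph V) : Hom H.diagonalGraph H where
  toFun z := z.1.2
  map_rel' h := h.2

theorem diagonalGraph_connected (hH : H.Connected) : H.diagonalGraph.Connected := by
  have hsymm : ∀ {z w}, H.diagonalGraph.Reachable z w → H.diagonalGraph.Reachable w z :=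
    fun h => by
      induction h with
      | refl => exact Relation.ReflTransGen.refl
      | tail _ hs ih => exact Relation.ReflTransGen.head (H.diagonalGraph.symm _ _ hs) ih
  have hd : ∀ x : V, (x, x) ∈ H.diagonalComponent :=
    fun x => ⟨(x, x), rfl, Relation.ReflTransGen.refl⟩
  obtain ⟨o⟩ := hH.1
  have h1 : ∀ x, H.diagonalGraph.Reachable ⟨(o, o), hd o⟩ ⟨(x, x), hd x⟩ := by
    intro x
    induction hH.2 o x with
    | refl => exact Relation.ReflTransGen.refl
    | tail _ hs ih => exact ih.tail ⟨hs, hs⟩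
  have h2 : ∀ z : H.diagonalComponent, H.diagonalGraph.Reachable ⟨(o, o), hd o⟩ z := by
    rintro ⟨z, ⟨d1, d2⟩, (rfl : d1 = d2), hz⟩
    suffices ∀ w (h : (H.prod H).Reachable (d1, d1) w),
        H.diagonalGraph.Reachable ⟨(o, o), hd o⟩ ⟨w, (d1, d1), rfl, h⟩ from this z hz
    intro w h
    induction h with
    | refl => exact h1 d1
    | tail h hs ih => exact ih.tail hs
  exact ⟨⟨⟨(o, o), hd o⟩⟩, fun z w => Relation.ReflTransGen.trans (hsymm (h2 z)) (h2 w)⟩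

open Classical in
theorem exists_isInterpolation_of_reachable (hN : ∀ x, ∃ y, H.Adj x y)
    {E : Set (Hom H.diagonalGraph H)}
    (hE : ∀ φ ∈ E, ∀ z : H.diagonalComponent, z.1.1 = z.1.2 → φ z = z.1.1)
    (h1 : H.diagonalFst ∈ E) (h2 : H.diagonalSnd ∈ E)
    (h : ((homGraph H.diagonalGraph H).induce E).Reachable ⟨_, h1⟩ ⟨_, h2⟩) :
    ∃ m F, IsInterpolation H m F := by
  obtain ⟨m, s, hs0, hsm, hs⟩ :=
    exists_sequence_of_reflTransGen (R := ((homGraph H.diagonalGraph H).induce E).Adj)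
      (fun φ => fun _ _ hxy => φ.1.map_rel hxy) h
  have hmem : ∀ {x y}, H.EvenReachable x y → (x, y) ∈ H.diagonalComponent :=
    fun h => (mem_diagonalComponent_iff hN).2 h
  refine ⟨m, fun i x y => if h : (x, y) ∈ H.diagonalComponent then (s i).1 ⟨(x, y), h⟩ else x,
    ⟨?_, ?_, ?_, ?_⟩, ?_⟩
  · intro x y he
    simp only [hmem he, dif_pos, hs0]
    rfl
  · intro i hi x y he
    simp only [hmem he, dif_pos, hsm i hi]
    rfl
  · intro i x y x' y' he hx hy
    simp only [hmem he, hmem (he.step hx hy), dif_pos]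
    exact (s i).1.map_rel ⟨hx, hy⟩
  · intro i x y x' y' he hx hy
    simp only [hmem he, hmem (he.step hx hy), dif_pos]
    exact hs i _ _ ⟨hx, hy⟩
  · intro i x
    simp only [hmem (.refl x), dif_pos]
    exact hE _ (s i).2 _ rfl

theorem ExtTrivial.exists_isInterpolation [Finite V] (hH : H.Connected)
    (hN : ∀ x, ∃ y, H.Adj x y) (h : H.ExtTrivial) : ∃ m F, IsInterpolation H m F := by
  let S : Set H.diagonalComponent := {z | z.1.1 = z.1.2}
  let p : S → V := fun z => z.1.1.1
  have h1 : H.diagonalFst ∈ extensions H.diagonalGraph H p := fun s => rfl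
  have h2 : H.diagonalSnd ∈ extensions H.diagonalGraph H p := fun s => s.2.symm
  exact exists_isInterpolation_of_reachable hN (E := extensions H.diagonalGraph H p)
    (fun φ hφ z hz => hφ ⟨z, hz⟩) h1 h2
    (h _ H.diagonalGraph (diagonalGraph_connected hH) S p ⟨_, h1⟩ ⟨_, h2⟩)

theorem BipartiteExtTrivial.exists_isInterpolation [Finite V] (hH : H.Connected)
    (hN : ∀ x, ∃ y, H.Adj x y) (h : H.BipartiteExtTrivial) : ∃ m F, IsInterpolation H m F := by
  obtain ⟨⟨c, hc⟩, h⟩ := h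
  let S : Set H.diagonalComponent := {z | z.1.1 = z.1.2}
  let p : S → V := fun z => z.1.1.1
  let cG : H.diagonalComponent → Bool := fun z => c z.1.1
  have h1 : H.diagonalFst ∈ colouredExtensions H.diagonalGraph H cG c p :=
    ⟨fun s => rfl, fun z => rfl⟩
  have h2 : H.diagonalSnd ∈ colouredExtensions H.diagonalGraph H cG c p :=
    ⟨fun s => s.2.symm, fun z =>
      (hc.eq_of_evenReachable ((mem_diagonalComponent_iff hN).1 z.2)).symm⟩
  exact exists_isInterpolation_of_reachable hN
    (E := colouredExtensions H.diagonalGraph H cG c p)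
    (fun φ hφ z hz => hφ.1 ⟨z, hz⟩) h1 h2
    (h c hc _ H.diagonalGraph (diagonalGraph_connected hH) cG (fun z w hzw => hc _ _ hzw.1)
      S p (fun _ => rfl) ⟨_, h1⟩ ⟨_, h2⟩)

/-- In an Ext-trivial graph, an edge and the reversed edge are joined by a path in the graph of
homomorphisms from `K₂`, so the ends of an edge are joined by an even walk. -/
theorem ExtTrivial.evenReachable_of_adj (h : H.ExtTrivial) {a b : V} (hab : H.Adj a b) :
    H.EvenReachable a b := by
  let G : LoopGraph (ULift.{u} Bool) := ⟨fun x y => x ≠ y, fun _ _ h => h.symm⟩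
  have hG : G.Connected := by
    refine ⟨⟨⟨true⟩⟩, fun x y => ?_⟩
    by_cases hxy : x = y
    · rw [hxy]; exact Relation.ReflTransGen.refl
    · exact Relation.ReflTransGen.single hxy
  have hhom : ∀ {a b}, H.Adj a b → ∀ {x y : ULift.{u} Bool}, G.Adj x y →
      H.Adj (if x.down then a else b) (if y.down then a else b) := by
    rintro a b hab ⟨_ | _⟩ ⟨_ | _⟩ hxy
    · exact absurd rfl hxy
    · exact H.symm _ _ hab
    · exact hab
    · exact absurd rfl hxy
  let p : (∅ : Set (ULift.{u} Bool)) → V := fun _ => a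
  have := h _ G hG ∅ p ⟨⟨_, hhom hab⟩, fun s => s.2.elim⟩
    ⟨⟨_, hhom (H.symm _ _ hab)⟩, fun s => s.2.elim⟩
  suffices ∀ φ ψ : extensions G H p, (relHomGraph G H p).Reachable φ ψ →
      H.EvenReachable (φ.1 ⟨true⟩) (ψ.1 ⟨true⟩) from this _ _ ‹_›
  intro φ ψ hφψ
  induction hφψ with
  | refl => exact .refl _
  | @tail θ θ' _ hs ih =>
    have hne : G.Adj ⟨false⟩ ⟨true⟩ := fun h => by simp at h
    exact ih.trans (.of_common (θ.1.map_rel hne) (hs _ _ hne))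

/-! ### Near unanimity on stiff graphs -/

/-- There is a walk with exactly `n` steps from `x` to `y`. -/
def HasWalk (H : LoopGraph V) : ℕ → V → V → Prop
  | 0, x, y => x = y
  | n + 1, x, y => ∃ z, H.Adj x z ∧ H.HasWalk n z y

theorem HasWalk.evenReachable {n : ℕ} {x y : V} (h : H.HasWalk (2 * n) x y) :
    H.EvenReachable x y := by
  induction n generalizing x with
  | zero => rw [show x = y from h]; exact .refl _
  | succ n ih =>
    obtain ⟨b, h1, c, h2, h3⟩ := h
    exact Relation.ReflTransGen.head ⟨b, h1, h2⟩ (ih h3)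

theorem EvenReachable.exists_hasWalk (hN : ∀ x, ∃ y, H.Adj x y) {x y : V}
    (h : H.EvenReachable x y) : ∃ m, ∀ n, m ≤ n → H.HasWalk (2 * n) x y := by
  induction h using Relation.ReflTransGen.head_induction_on with
  | refl =>
    refine ⟨0, fun n _ => ?_⟩
    induction n with
    | zero => rfl
    | succ n ih =>
      obtain ⟨z, hz⟩ := hN y
      exact ⟨z, hz, y, H.symm _ _ hz, ih (Nat.zero_le _)⟩
  | head hs _ ih =>
    obtain ⟨b, h1, h2⟩ := hs
    obtain ⟨m, hm⟩ := ih
    refine ⟨m + 1, fun n hn => ?_⟩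
    obtain ⟨n, rfl⟩ : ∃ k, n = k + 1 := ⟨n - 1, by omega⟩
    exact ⟨b, h1, _, h2, hm n (by omega)⟩

open Classical in
/-- Nesting a near unanimity operation in itself produces operations that ignore any given
number of deviating arguments. -/
theorem exists_tolerant {k : ℕ} {f : (Fin k → V) → V}
    (hf : ∀ x y, (∀ i, H.Adj (x i) (y i)) → H.Adj (f x) (f y)) (hnu : IsNearUnanimity f)
    (d : ℕ) : ∃ (ι : Type) (_ : Fintype ι) (g : (ι → V) → V),
      (∀ x y, (∀ i, H.Adj (x i) (y i)) → H.Adj (g x) (g y)) ∧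
      ∀ (x : ι → V) (a : V) (T : Finset ι), T.card ≤ d → (∀ i ∉ T, x i = a) → g x = a := by
  induction d with
  | zero =>
    refine ⟨Unit, inferInstance, fun x => x (), fun x y h => h (), fun x a T hT h => ?_⟩
    exact h () (by simp [Finset.card_eq_zero.1 (Nat.le_zero.1 hT)])
  | succ d ih =>
    obtain ⟨ι, _, g, hg, ht⟩ := ih
    refine ⟨Fin k × ι, inferInstance, fun x => f fun i => g fun j => x (i, j),
      fun x y h => hf _ _ fun i => hg _ _ fun j => h _, fun x a T hT h => ?_⟩
    have hblock : ∀ i, (Finset.univ.filter fun j => (i, j) ∈ T).card ≤ d →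
        (g fun j => x (i, j)) = a := fun i hi =>
      ht _ a _ hi fun j hj => h _ (by simpa using hj)
    by_cases hall : ∀ i, (Finset.univ.filter fun j => (i, j) ∈ T).card ≤ d
    · exact hnu.2 _ a ⟨0, by have := hnu.1; omega⟩ fun i _ => hblock i (hall i)
    · push Not at hall
      obtain ⟨i₀, hi₀⟩ := hall
      refine hnu.2 _ a i₀ fun i hi => hblock i ?_
      -- all deviating arguments lie in the block `i₀`
      have hsub : (Finset.univ.filter fun j => (i₀, j) ∈ T).map
          ⟨fun j => (i₀, j), fun j j' h => (Prod.ext_iff.1 h).2⟩ ⊆ T := by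
        intro p hp
        simp only [Finset.mem_map, Finset.mem_filter, Finset.mem_univ, true_and] at hp
        obtain ⟨j, hj, rfl⟩ := hp
        exact hj
      have heq := Finset.eq_of_subset_of_card_le hsub (by rw [Finset.card_map]; omega)
      have : (Finset.univ.filter fun j => (i, j) ∈ T) = ∅ := by
        refine Finset.filter_eq_empty_iff.2 fun j _ hj => hi ?_
        rw [← heq] at hj
        simp only [Finset.mem_map] at hj
        obtain ⟨j', _, hj'⟩ := hj
        exact (Prod.ext_iff.1 hj').1.symm
      simp [this]

open Classical in
/-- A pursuit game. The arguments indexed by `J` are cops walking to the targets `v` and the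
common value `a` of the remaining arguments is a robber. If, wherever the robber goes, a cop meets
him after `n` steps, then at that moment one argument fewer deviates; as no vertex is dominated by
another one, the equation `g x = a` propagates back in time. -/
theorem eq_of_pursuit (hstiff : ∀ a b, (∀ w, H.Adj a w → H.Adj b w) → b = a) {ι : Type}
    {g : (ι → V) → V} (hg : ∀ x y, (∀ i, H.Adj (x i) (y i)) → H.Adj (g x) (g y)) {r : ℕ}
    (hr : ∀ (x : ι → V) (a : V) (T : Finset ι), T.card ≤ r → (∀ i, H.EvenReachable a (x i)) →
      (∀ i ∉ T, x i = a) → g x = a)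
    (J : Finset ι) (hJ : J.card ≤ r + 1) (v : ι → V) (n : ℕ) (x : ι → V) (a : V)
    (he : ∀ i, H.EvenReachable a (x i)) (hx : ∀ i ∉ J, x i = a)
    (hv : ∀ j ∈ J, H.HasWalk n (x j) (v j))
    (hc : ∀ b, H.HasWalk n a b → ∃ j ∈ J, v j = b) : g x = a := by
  induction n generalizing x a with
  | zero =>
    obtain ⟨j, hj, hja⟩ := hc a rfl
    refine hr x a (J.erase j) (by rw [Finset.card_erase_of_mem hj]; omega) he fun i hi => ?_
    by_cases hij : i = j
    · rw [hij, show x j = v j from hv j hj, hja]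
    · exact hx i fun h => hi (Finset.mem_erase.2 ⟨hij, h⟩)
  | succ n ih =>
    refine hstiff _ _ fun w haw => ?_
    have : Nonempty V := ⟨a⟩
    choose! z hz hzv using hv
    have hadj : ∀ i, H.Adj (x i) (if i ∈ J then z i else w) := by
      intro i
      split_ifs with h
      · exact hz i h
      · rw [hx i h]; exact haw
    have := ih (fun i => if i ∈ J then z i else w) w (fun i => (he i).step haw (hadj i))
      (fun i hi => if_neg hi) (fun j hj => by simpa only [hj, if_true] using hzv j hj)
      fun b hb => hc b ⟨w, haw, hb⟩
    exact this ▸ hg _ _ hadj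

open Classical in
/-- In a stiff graph (no vertex is dominated by another one) with a near unanimity operation, every
even walk is closed: otherwise the iterated operation would take the value `a` at the constant
tuple `b`. -/
theorem eq_of_evenReachable_of_stiff [Finite V] (hN : ∀ x, ∃ y, H.Adj x y)
    (hstiff : ∀ a b, (∀ w, H.Adj a w → H.Adj b w) → b = a) {k : ℕ} {f : (Fin k → V) → V}
    (hf : ∀ x y, (∀ i, H.Adj (x i) (y i)) → H.Adj (f x) (f y)) (hnu : IsNearUnanimity f)
    {a b : V} (hab : H.EvenReachable a b) : a = b := by
  have := Fintype.ofFinite V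
  obtain ⟨ι, _, g, hg, ht⟩ := exists_tolerant hf hnu (Fintype.card V)
  have key : ∀ r, ∀ (x : ι → V) (a : V) (T : Finset ι), T.card ≤ r →
      (∀ i, H.EvenReachable a (x i)) → (∀ i ∉ T, x i = a) → g x = a := by
    intro r
    induction r with
    | zero => exact fun x a T hT _ => ht x a T (hT.trans (Nat.zero_le _))
    | succ r ih =>
      intro x a T hT he hx
      by_cases hcard : T.card ≤ Fintype.card V
      · exact ht x a T hcard hx
      -- there are enough cops to occupy every vertex that the robber can reach
      obtain ⟨e⟩ : Nonempty (V ↪ T) :=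
        Function.Embedding.nonempty_of_card_le (by simpa using (not_le.1 hcard).le)
      have : Nonempty V := ⟨a⟩
      let c : ι → V := fun i => if h : i ∈ T then Function.invFun e ⟨i, h⟩ else a
      have hc : ∀ b, ∃ j ∈ T, c j = b := fun b =>
        ⟨e b, (e b).2, by
          simp only [c, (e b).2, dif_pos]
          exact Function.leftInverse_invFun e.injective b⟩
      let v : ι → V := fun i => if H.EvenReachable a (c i) then c i else a
      have hv : ∀ i, H.EvenReachable (x i) (v i) := by
        intro i
        by_cases h : H.EvenReachable a (c i)
        · simpa only [v, h, if_true] using (he i).symm.trans h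
        · simpa only [v, h, if_false] using (he i).symm
      choose M hM using fun i => (hv i).exists_hasWalk hN
      refine eq_of_pursuit hstiff hg ih T hT v (2 * ∑ i, M i) x a he hx (fun j _ => ?_) ?_
      · exact hM j _ (Finset.single_le_sum (fun _ _ => Nat.zero_le _) (Finset.mem_univ j))
      · intro b hb
        obtain ⟨j, hj, rfl⟩ := hc b
        exact ⟨j, hj, if_pos hb.evenReachable⟩
  have h1 := key _ (fun _ => b) a Finset.univ le_rfl (fun _ => hab) (by simp)
  have h2 := ht (fun _ => b) b ∅ (by simp) (by simp)
  exact h1.symm.trans h2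

theorem exists_dismantles_stiff [Finite V] (H : LoopGraph V) :
    ∃ T, H.Dismantles Set.univ T ∧
      ∀ a ∈ T, ∀ b ∈ T, (∀ w ∈ T, H.Adj a w → H.Adj b w) → b = a := by
  obtain ⟨T, hT, hmin⟩ := (measure (Set.ncard (α := V))).wf.has_min
    {T | H.Dismantles Set.univ T} ⟨_, Relation.ReflTransGen.refl⟩
  refine ⟨T, hT, fun a ha b hb h => ?_⟩
  by_contra hba
  refine hmin (T \ {a}) (Relation.ReflTransGen.tail hT ⟨a, b, hba, ⟨ha, hb, h⟩, rfl⟩) ?_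
  exact Set.ncard_lt_ncard ⟨Set.sdiff_subset, fun h => (h ha).2 rfl⟩ (Set.toFinite _)

/-- A near unanimity graph can be deformed, within itself, so that the ends of every even walk
are identified. -/
theorem exists_isDeformation_of_nearUnanimity [Finite V] (hN : ∀ x, ∃ y, H.Adj x y) {k : ℕ}
    {f : (Fin k → V) → V} (hf : ∀ x y, (∀ i, H.Adj (x i) (y i)) → H.Adj (f x) (f y))
    (hnu : IsNearUnanimity f) :
    ∃ T m r, IsDeformation H Set.univ T m r ∧
      ∀ {x y}, H.EvenReachable x y → r m x = r m y := by
  obtain ⟨T, hT, hstiff⟩ := exists_dismantles_stiff H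
  obtain ⟨m, r, hr⟩ := hT.exists_isDeformation
  refine ⟨T, m, r, hr, fun {x y} he => ?_⟩
  let ρ : V → T := fun x => ⟨r m x, hr.last le_rfl (Set.mem_univ x)⟩
  have hρ : ∀ x y, H.Adj x y → (H.induce T).Adj (ρ x) (ρ y) := fun x y h =>
    hr.adj m (Set.mem_univ x) (Set.mem_univ y) h
  have hρT : ∀ x : T, ρ x = x := fun x => Subtype.ext (hr.fix m x.2)
  have h : ρ x = ρ y := by
    refine eq_of_evenReachable_of_stiff (H := H.induce T) (f := fun x => ρ (f fun i => x i))
      (fun x => ?_) (fun a b hab => ?_) (fun x y hxy => hρ _ _ (hf _ _ hxy))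
      ⟨hnu.1, fun x a j hx => ?_⟩ (he.map ρ hρ)
    · obtain ⟨y, hy⟩ := hN x
      exact ⟨ρ y, by simpa [hρT] using hρ _ _ hy⟩
    · exact Subtype.ext (hstiff a a.2 b b.2 fun w hw => hab ⟨w, hw⟩)
    · show ρ (f fun i => x i) = a
      rw [hnu.2 _ (a : V) j fun i hi => congrArg _ (hx i hi), hρT]
  exact congrArg Subtype.val h

/-- A homotopy between the two projections that need not fix the diagonal is made idempotent with
a near unanimity operation `f`: its arguments traverse the homotopy one after the other, so that
at any time all but one of them are values of a projection. -/
theorem IsPairHomotopy.exists_isInterpolation {k : ℕ} {f : (Fin k → V) → V}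
    (hf : ∀ x y, (∀ i, H.Adj (x i) (y i)) → H.Adj (f x) (f y)) (hnu : IsNearUnanimity f)
    {n : ℕ} {h : ℕ → V → V → V} (hh : IsPairHomotopy H n h) : ∃ m F, IsInterpolation H m F := by
  have hconst : ∀ (x : Fin k → V) a, (∀ i, x i = a) → f x = a := fun x a hx =>
    hnu.2 x a ⟨0, by have := hnu.1; omega⟩ fun i _ => hx i
  refine ⟨k * (n + 1), fun i x y => f fun l : Fin k => h (i - l * (n + 1)) x y,
    ⟨fun he => ?_, fun {i} hi {x y} he => ?_, fun i x y x' y' he hx hy => ?_,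
      fun i x y x' y' he hx hy => ?_⟩, fun i x => ?_⟩
  · exact hconst _ _ fun l => by rw [Nat.zero_sub, hh.zero he]
  · refine hconst _ _ fun l => hh.last ?_ he
    have : (l + 1) * (n + 1) ≤ k * (n + 1) := Nat.mul_le_mul_right _ l.2
    have := add_mul (l : ℕ) 1 (n + 1)
    omega
  · exact hf _ _ fun l => hh.adj _ he hx hy
  · exact hf _ _ fun l => hh.adj_of_le (by omega) (by omega) he hx hy
  · have key : ∀ l : ℕ, l ≠ i / (n + 1) → h (i - l * (n + 1)) x x = x := by
      intro l hl
      rcases lt_or_gt_of_ne hl with hl | hl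
      · refine hh.last ?_ (.refl x)
        have h1 := Nat.mul_le_mul_right (n + 1) (Nat.succ_le_of_lt hl)
        have h2 := Nat.div_mul_le_self i (n + 1)
        have := add_mul l 1 (n + 1)
        simp only [Nat.succ_eq_add_one] at h1
        omega
      · have h1 : i < l * (n + 1) := (Nat.div_lt_iff_lt_mul (Nat.succ_pos n)).1 hl
        rw [Nat.sub_eq_zero_of_le h1.le, hh.zero (.refl x)]
    by_cases hi : i / (n + 1) < k
    · exact hnu.2 _ x ⟨_, hi⟩ fun l hl => key l fun h => hl (Fin.ext h)
    · exact hconst _ _ fun l => key l fun h => hi (h ▸ l.2)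

theorem HasNUPolymorphism.exists_isInterpolation [Finite V] (hN : ∀ x, ∃ y, H.Adj x y)
    (h : H.HasNUPolymorphism) : ∃ m F, IsInterpolation H m F := by
  obtain ⟨k, f, hnu⟩ := h
  have hf : ∀ x y : Fin k → V, (∀ i, H.Adj (x i) (y i)) → H.Adj (f x) (f y) :=
    fun x y hxy => f.map_rel hxy
  obtain ⟨T, m, r, hr, heq⟩ := exists_isDeformation_of_nearUnanimity hN hf hnu
  have hadj : ∀ i {x y}, H.Adj x y → H.Adj (r i x) (r i y) ∧ H.Adj (r i x) (r (i + 1) y) :=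
    fun i x y hxy => ⟨hr.adj i (Set.mem_univ _) (Set.mem_univ _) hxy,
      hr.adj_succ i (Set.mem_univ _) (Set.mem_univ _) hxy⟩
  exact (exists_isPairHomotopy (m := m) (p := fun i x _ => r i x) (q := fun i _ y => r i y)
    (fun _ => hr.zero (Set.mem_univ _)) (fun _ => hr.zero (Set.mem_univ _)) heq
    (fun i _ _ _ _ _ hx _ => hadj i hx) (fun i _ _ _ _ _ _ hy => hadj i hy)).exists_isInterpolation
    hf hnu

/-- An Ext-trivial near unanimity graph with an edge has a loop: the ends of the edge are joined
by an even walk, so a deformation identifies them. -/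
theorem ExtTrivial.exists_loop [Finite V] (hN : ∀ x, ∃ y, H.Adj x y) (h : H.ExtTrivial)
    (hnu : H.HasNUPolymorphism) {a b : V} (hab : H.Adj a b) : ∃ x, H.Adj x x := by
  obtain ⟨k, f, hnu⟩ := hnu
  obtain ⟨T, m, r, hr, heq⟩ := exists_isDeformation_of_nearUnanimity hN
    (fun x y hxy => f.map_rel hxy) hnu
  have := hr.adj m (Set.mem_univ _) (Set.mem_univ _) hab
  rw [heq (h.evenReachable_of_adj hab)] at this
  exact ⟨_, this⟩

/-! ### List colourings: from local to global solutions -/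

/-- `φ` restricts to a list homomorphism from the subgraph of `G` induced on `W` to `H`, where the
value at `x` has to be taken from the list `L x`. -/
def IsSolOn (G : LoopGraph U) (H : LoopGraph V) (L : U → Set V) (W : Set U) (φ : U → V) : Prop :=
  (∀ x ∈ W, ∀ y ∈ W, G.Adj x y → H.Adj (φ x) (φ y)) ∧ ∀ x ∈ W, φ x ∈ L x

theorem IsSolOn.mono {L : U → Set V} {W W' : Set U} {φ : U → V} (h : IsSolOn G H L W φ)
    (hW : W' ⊆ W) : IsSolOn G H L W' φ :=
  ⟨fun x hx y hy => h.1 x (hW hx) y (hW hy), fun x hx => h.2 x (hW hx)⟩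

/-- Any two members of a list are joined by an even walk, and the lists are closed under the
interpolation `F`. -/
def ListsClosed (H : LoopGraph V) (F : ℕ → V → V → V) (L : U → Set V) : Prop :=
  ∀ u, ∀ a ∈ L u, ∀ b ∈ L u, H.EvenReachable a b ∧ ∀ i, F i a b ∈ L u

/-- The vertices that can be reached from `u` in at most `n` steps inside `W`. -/
def ball (G : LoopGraph U) (W : Set U) (u : U) : ℕ → Set U
  | 0 => {u}
  | n + 1 => {z | z ∈ G.ball W u n ∨ z ∈ W ∧ ∃ y ∈ G.ball W u n, G.Adj y z}

theorem ball_mono {W : Set U} {u : U} {i j : ℕ} (h : i ≤ j) : G.ball W u i ⊆ G.ball W u j := by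
  induction h with
  | refl => exact subset_rfl
  | step _ ih => exact fun z hz => .inl (ih hz)

theorem ball_subset_univ {W : Set U} {u : U} (n : ℕ) : G.ball W u n ⊆ G.ball Set.univ u n := by
  induction n with
  | zero => exact subset_rfl
  | succ n ih =>
    rintro z (hz | ⟨_, y, hy, hyz⟩)
    · exact .inl (ih hz)
    · exact .inr ⟨trivial, y, ih hy, hyz⟩

open Classical in
/-- If all balls of a fixed radius have list homomorphisms to `H`, then so has the whole graph.
In a minimal set without solution, two vertices `u`, `w` far apart could be removed in turn, and
the two resulting solutions could be interpolated according to the distance from `u`. -/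
theorem exists_isSolOn_of_local [Finite U] {m : ℕ} {F : ℕ → V → V → V}
    (hF : IsInterpolation H m F) {L : U → Set V} (hL : ListsClosed H F L)
    (hloc : ∀ u, ∃ φ, IsSolOn G H L (G.ball Set.univ u (m + 1)) φ) :
    ∃ φ, IsSolOn G H L Set.univ φ := by
  by_contra hcon
  obtain ⟨W, hW, hmin⟩ := (measure (Set.ncard (α := U))).wf.has_min
    {W | ¬ ∃ φ, IsSolOn G H L W φ} ⟨_, hcon⟩
  have hmin' : ∀ z ∈ W, ∃ φ, IsSolOn G H L (W \ {z}) φ := by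
    intro z hz
    by_contra h
    exact hmin _ h (Set.ncard_lt_ncard ⟨Set.sdiff_subset, fun h => (h hz).2 rfl⟩ (Set.toFinite _))
  obtain ⟨u, hu⟩ : W.Nonempty := by
    by_contra h
    rw [Set.not_nonempty_iff_eq_empty] at h
    subst h
    refine hW ?_
    rcases isEmpty_or_nonempty U with _ | ⟨⟨o⟩⟩
    · exact ⟨isEmptyElim, by simp [IsSolOn]⟩
    · obtain ⟨φ, _⟩ := hloc o
      exact ⟨φ, by simp [IsSolOn]⟩
  by_cases hsub : W ⊆ G.ball W u (m + 1)
  · obtain ⟨φ, hφ⟩ := hloc u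
    exact hW ⟨φ, hφ.mono (hsub.trans (ball_subset_univ _))⟩
  obtain ⟨w, hw, hwb⟩ := Set.not_subset.1 hsub
  obtain ⟨φ, hφ⟩ := hmin' w hw
  obtain ⟨ψ, hψ⟩ := hmin' u hu
  -- the distance from `u` in `W`, truncated at `m + 2`
  have hex : ∀ z, ∃ i, z ∈ G.ball W u i ∨ m + 2 ≤ i := fun z => ⟨m + 2, .inr le_rfl⟩
  let d : U → ℕ := fun z => Nat.find (hex z)
  have hd_spec : ∀ z, z ∈ G.ball W u (d z) ∨ m + 2 ≤ d z := fun z => Nat.find_spec (hex z)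
  have hd_le : ∀ {z i}, z ∈ G.ball W u i → d z ≤ i := fun h => Nat.find_min' _ (.inl h)
  have hd_le' : ∀ z, d z ≤ m + 2 := fun z => Nat.find_min' _ (.inr le_rfl)
  have hd_adj : ∀ {x y}, y ∈ W → G.Adj x y → d y ≤ d x + 1 := by
    intro x y hy hxy
    rcases hd_spec x with h | h
    · exact hd_le (.inr ⟨hy, x, h, hxy⟩)
    · exact (hd_le' y).trans (by omega)
  have hdw : m + 2 ≤ d w := by
    rcases hd_spec w with h | h
    · by_contra h'
      exact hwb (ball_mono (by omega) h)
    · exact h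
  have hdu : d u = 0 := Nat.le_zero.1 (hd_le (i := 0) rfl)
  have huw : u ≠ w := by
    rintro rfl
    omega
  have hwu : ¬ G.Adj u w := fun h => by
    have := hd_adj hw h
    omega
  have hcl : ∀ z ∈ W, z ≠ u → z ≠ w → H.EvenReachable (φ z) (ψ z) ∧
      ∀ i, F i (φ z) (ψ z) ∈ L z := fun z hz h1 h2 =>
    hL z _ (hφ.2 z ⟨hz, h2⟩) _ (hψ.2 z ⟨hz, h1⟩)
  let χ : U → V := fun z =>
    if z = u then φ u else if z = w then ψ w else F (d z - 1) (φ z) (ψ z)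
  have hχu : χ u = φ u := if_pos rfl
  have hχw : χ w = ψ w := by simp only [χ, huw.symm, if_false, if_true]
  have hχ : ∀ z, z ≠ u → z ≠ w → χ z = F (d z - 1) (φ z) (ψ z) := fun z h1 h2 => by
    simp only [χ, h1, h2, if_false]
  have adj_u : ∀ y ∈ W, G.Adj u y → H.Adj (χ u) (χ y) := by
    intro y hy huy
    have hyw : y ≠ w := fun h => hwu (h ▸ huy)
    have h := hφ.1 u ⟨hu, huw⟩ y ⟨hy, hyw⟩ huy
    rw [hχu]
    by_cases hyu : y = u
    · subst hyu
      rwa [hχu]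
    · have := hd_adj hy huy
      rw [hχ y hyu hyw, show d y - 1 = 0 by omega, hF.zero (hcl y hy hyu hyw).1]
      exact h
  have adj_w : ∀ y ∈ W, G.Adj w y → H.Adj (χ w) (χ y) := by
    intro y hy hwy
    have hyu : y ≠ u := fun h => hwu (h ▸ G.symm _ _ hwy)
    have h := hψ.1 w ⟨hw, huw.symm⟩ y ⟨hy, hyu⟩ hwy
    rw [hχw]
    by_cases hyw : y = w
    · subst hyw
      rwa [hχw]
    · have := hd_adj hw (G.symm _ _ hwy)
      rw [hχ y hyu hyw, hF.last (by omega) (hcl y hy hyu hyw).1]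
      exact h
  refine hW ⟨χ, fun x hx y hy hxy => ?_, fun x hx => ?_⟩
  · by_cases hxu : x = u
    · subst hxu
      exact adj_u y hy hxy
    by_cases hxw : x = w
    · subst hxw
      exact adj_w y hy hxy
    by_cases hyu : y = u
    · subst hyu
      exact H.symm _ _ (adj_u x hx (G.symm _ _ hxy))
    by_cases hyw : y = w
    · subst hyw
      exact H.symm _ _ (adj_w x hx (G.symm _ _ hxy))
    rw [hχ x hxu hxw, hχ y hyu hyw]
    have h1 := hd_adj hy hxy
    have h2 := hd_adj hx (G.symm _ _ hxy)
    exact hF.adj_of_le (by omega) (by omega) (hcl x hx hxu hxw).1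
      (hφ.1 x ⟨hx, hxw⟩ y ⟨hy, hyw⟩ hxy) (hψ.1 x ⟨hx, hxu⟩ y ⟨hy, hyu⟩ hxy)
  · by_cases hxu : x = u
    · subst hxu
      rw [hχu]
      exact hφ.2 x ⟨hx, huw⟩
    by_cases hxw : x = w
    · subst hxw
      rw [hχw]
      exact hψ.2 x ⟨hx, huw.symm⟩
    rw [hχ x hxu hxw]
    exact (hcl x hx hxu hxw).2 _

/-! ### Invariant cliques in contractible graphs -/

open Classical in
/-- A finite reflexive graph that can be contracted to a vertex has a nonempty clique that is
invariant under all automorphisms. The vertices with a maximal neighbourhood form an invariant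
retract, which is again contractible; if it is the whole graph, then along a contraction no
neighbourhood ever changes, so all vertices have the same neighbours. -/
theorem exists_invariant_clique {X : Type*} [Finite X] {R : X → X → Prop}
    (hrefl : ∀ x, R x x) (hsymm : ∀ x y, R x y → R y x) (Y : Set X) (hne : Y.Nonempty)
    (hinv : ∀ σ : Equiv.Perm X, (∀ x y, R x y ↔ R (σ x) (σ y)) → ∀ x ∈ Y, σ x ∈ Y)
    (m : ℕ) (D : ℕ → X → X) (x₀ : X) (h0 : ∀ x ∈ Y, D 0 x = x) (hm : ∀ x ∈ Y, D m x = x₀)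
    (hY : ∀ i, ∀ x ∈ Y, D i x ∈ Y)
    (hD : ∀ i, ∀ x ∈ Y, ∀ y ∈ Y, R x y → R (D i x) (D i y) ∧ R (D i x) (D (i + 1) y)) :
    ∃ C : Set X, C.Nonempty ∧
      (∀ σ : Equiv.Perm X, (∀ x y, R x y ↔ R (σ x) (σ y)) → ∀ x ∈ C, σ x ∈ C) ∧
      ∀ x ∈ C, ∀ y ∈ C, R x y := by
  induction hn : Y.ncard using Nat.strong_induction_on generalizing Y D x₀ with
  | _ n ih =>
  subst hn
  let Y' : Set X := {a | a ∈ Y ∧ ∀ b ∈ Y, (∀ z ∈ Y, R a z → R b z) → ∀ z ∈ Y, R b z → R a z}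
  have hsub : Y' ⊆ Y := fun a ha => ha.1
  by_cases hall : Y ⊆ Y'
  · have key : ∀ i, ∀ a ∈ Y, ∀ z ∈ Y, R (D i a) z ↔ R a z := by
      intro i
      induction i with
      | zero => exact fun a ha z _ => by rw [h0 a ha]
      | succ i ih =>
        intro a ha z hz
        have hle : ∀ z ∈ Y, R a z → R (D (i + 1) a) z := fun z hz haz =>
          hsymm _ _ ((ih z hz _ (hY _ a ha)).1 (hD i z hz a ha (hsymm _ _ haz)).2)
        exact ⟨(hall ha).2 _ (hY _ a ha) hle z hz, hle z hz⟩
    refine ⟨Y, hne, hinv, fun a ha b hb => ?_⟩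
    rw [← key m a ha b hb, hm a ha, ← hm b hb, key m b hb b hb]
    exact hrefl b
  have hmax : ∀ a ∈ Y, ∃ b ∈ Y', (∀ z ∈ Y, R a z → R b z) ∧ (a ∈ Y' → b = a) := by
    intro a ha
    by_cases haY : a ∈ Y'
    · exact ⟨a, haY, fun _ _ h => h, fun _ => rfl⟩
    obtain ⟨b, ⟨hb, hab⟩, hbmax⟩ := Set.exists_max_image
      {b | b ∈ Y ∧ ∀ z ∈ Y, R a z → R b z} (fun b => {z | z ∈ Y ∧ R b z}.ncard) (Set.toFinite _)
      ⟨a, ha, fun _ _ h => h⟩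
    refine ⟨b, ⟨hb, fun c hc hbc z hz hcz => ?_⟩, hab, fun h => absurd h haY⟩
    have hle := hbmax c ⟨hc, fun z hz h => hbc z hz (hab z hz h)⟩
    have heq : {z | z ∈ Y ∧ R b z} = {z | z ∈ Y ∧ R c z} :=
      Set.eq_of_subset_of_ncard_le (fun z hz => ⟨hz.1, hbc z hz.1 hz.2⟩) hle (Set.toFinite _)
    exact (heq.symm ▸ (⟨hz, hcz⟩ : z ∈ {z | z ∈ Y ∧ R c z}) : z ∈ {z | z ∈ Y ∧ R b z}).2
  obtain ⟨x₁, hx₁⟩ := hne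
  have : Nonempty X := ⟨x₁⟩
  choose! ρ hρY hρN hρid using hmax
  have hρ : ∀ x ∈ Y, ∀ y ∈ Y, R x y → R (ρ x) (ρ y) := fun x hx y hy hxy =>
    hρN x hx _ (hsub (hρY y hy)) (hsymm _ _ (hρN y hy _ hx (hsymm _ _ hxy)))
  refine ih Y'.ncard (Set.ncard_lt_ncard ⟨hsub, hall⟩ (Set.toFinite _)) Y' ⟨_, hρY x₁ hx₁⟩ ?_
    (fun i x => ρ (D i x)) (ρ x₀) ?_ ?_ ?_ ?_ rfl
  · rintro σ hσ a ⟨ha, hamax⟩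
    have hσ' : ∀ x y, R x y ↔ R (σ.symm x) (σ.symm y) := fun x y => by
      rw [hσ (σ.symm x), σ.apply_symm_apply, σ.apply_symm_apply]
    refine ⟨hinv σ hσ a ha, fun b hb hab z hz hbz => ?_⟩
    rw [hσ', σ.symm_apply_apply]
    refine hamax (σ.symm b) (hinv _ hσ' b hb) (fun y hy hay => ?_) _ (hinv _ hσ' z hz)
      ((hσ' _ _).1 hbz)
    rw [hσ, σ.apply_symm_apply]
    exact hab _ (hinv σ hσ y hy) ((hσ _ _).1 hay)
  · intro x hx
    rw [h0 x (hsub hx), hρid x (hsub hx) hx]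
  · intro x hx
    rw [hm x (hsub hx)]
  · exact fun i x hx => hρY _ (hY i x (hsub hx))
  · intro i x hx y hy hxy
    have h := hD i x (hsub hx) y (hsub hy) hxy
    exact ⟨hρ _ (hY i x (hsub hx)) _ (hY i y (hsub hy)) h.1,
      hρ _ (hY i x (hsub hx)) _ (hY _ y (hsub hy)) h.2⟩

/-! ### Finite covers -/

/-- The cover of `G` with fibre a group `Γ` in which an edge `e` shifts the fibre by the
involution `γ e`. -/
def cover (G : LoopGraph U) {Γ : Type*} [Group Γ] (γ : Sym2 U → Γ) (hγ : ∀ e, γ e * γ e = 1) :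
    LoopGraph (U × Γ) where
  Adj x y := G.Adj x.1 y.1 ∧ y.2 = x.2 * γ s(x.1, y.1)
  symm x y h := ⟨G.symm _ _ h.1, by rw [h.2, Sym2.eq_swap, mul_assoc, hγ, mul_one]⟩

/-- A list homomorphism from a finite cover yields one from `G`: the list homomorphisms from the
cover form a contractible graph, hence they contain a clique that is invariant under the deck
transformations, and any member of it descends to the base. -/
theorem exists_isSolOn_of_cover [Finite U] [Finite V] {Γ : Type*} [Group Γ] [Finite Γ]
    {γ : Sym2 U → Γ} {hγ : ∀ e, γ e * γ e = 1} {m : ℕ} {F : ℕ → V → V → V}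
    (hF : IsInterpolation H m F) {L : U → Set V} (hL : ListsClosed H F L)
    (h : ∃ φ, IsSolOn (G.cover γ hγ) H (fun z => L z.1) Set.univ φ) :
    ∃ φ, IsSolOn G H L Set.univ φ := by
  obtain ⟨φ₀, hφ₀⟩ := h
  let X := {φ : U × Γ → V // IsSolOn (G.cover γ hγ) H (fun z => L z.1) Set.univ φ}
  have hX : ∀ (φ : X) {x y}, (G.cover γ hγ).Adj x y → H.Adj (φ.1 x) (φ.1 y) :=
    fun φ x y hxy => φ.2.1 x trivial y trivial hxy
  have hmem : ∀ (φ : X) x, φ.1 x ∈ L x.1 := fun φ x => φ.2.2 x trivial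
  let R : X → X → Prop := fun φ ψ => ∀ x y, (G.cover γ hγ).Adj x y → H.Adj (φ.1 x) (ψ.1 y)
  have hcl : ∀ (φ : X) x, H.EvenReachable (φ.1 x) (φ₀ x) ∧ ∀ i, F i (φ.1 x) (φ₀ x) ∈ L x.1 :=
    fun φ x => hL _ _ (hmem φ x) _ (hφ₀.2 x trivial)
  let D : ℕ → X → X := fun i φ => ⟨fun x => F i (φ.1 x) (φ₀ x),
    fun x _ y _ hxy => hF.adj i (hcl φ x).1 (hX φ hxy) (hφ₀.1 x trivial y trivial hxy),
    fun x _ => (hcl φ x).2 i⟩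
  have hshift : ∀ (g : Γ) (φ : X), IsSolOn (G.cover γ hγ) H (fun z => L z.1) Set.univ
      fun z => φ.1 (z.1, g * z.2) := fun g φ =>
    ⟨fun x _ y _ hxy => hX φ ⟨hxy.1, by rw [hxy.2, mul_assoc]⟩, fun x _ => hmem φ (x.1, g * x.2)⟩
  let σ : Γ → Equiv.Perm X := fun g =>
    ⟨fun φ => ⟨_, hshift g φ⟩, fun φ => ⟨_, hshift g⁻¹ φ⟩,
      fun φ => Subtype.ext (funext fun z => by simp),
      fun φ => Subtype.ext (funext fun z => by simp)⟩
  have hσR : ∀ g φ ψ, R φ ψ → R (σ g φ) (σ g ψ) := fun g φ ψ h x y hxy =>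
    h (x.1, g * x.2) (y.1, g * y.2) ⟨hxy.1, by rw [hxy.2, mul_assoc]⟩
  have hσ : ∀ g φ ψ, R φ ψ ↔ R (σ g φ) (σ g ψ) := by
    refine fun g φ ψ => ⟨hσR g φ ψ, fun h => ?_⟩
    have h' := hσR g⁻¹ _ _ h
    have hinv : ∀ φ, σ g⁻¹ (σ g φ) = φ := fun φ => Subtype.ext (funext fun z => by simp [σ])
    rwa [hinv, hinv] at h'
  obtain ⟨C, ⟨φ, hφ⟩, hCinv, hC⟩ := exists_invariant_clique (R := R)
    (fun φ x y hxy => hX φ hxy)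
    (fun φ ψ h x y hxy => H.symm _ _ (h y x ((G.cover γ hγ).symm _ _ hxy)))
    Set.univ ⟨⟨φ₀, hφ₀⟩, trivial⟩ (fun _ _ _ _ => trivial) m D ⟨φ₀, hφ₀⟩
    (fun φ _ => Subtype.ext (funext fun x => hF.zero (hcl φ x).1))
    (fun φ _ => Subtype.ext (funext fun x => hF.last le_rfl (hcl φ x).1))
    (fun _ _ _ => trivial)
    (fun i φ _ ψ _ h => ⟨fun x y hxy => hF.adj i (hcl φ x).1 (h x y hxy)
        (hφ₀.1 x trivial y trivial hxy),
      fun x y hxy => hF.adj_succ i (hcl φ x).1 (h x y hxy) (hφ₀.1 x trivial y trivial hxy)⟩)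
  refine ⟨fun x => φ.1 (x, 1), fun x _ y _ hxy => ?_, fun x _ => hmem φ (x, 1)⟩
  -- the translate of `φ` is adjacent to `φ`, and takes the value `φ (y, 1)` at the end `(y, γ e)`
  -- of the lift of the edge `e = xy` that starts in `(x, 1)`
  have := hC φ hφ _ (hCinv (σ (γ s(x, y))⁻¹) (hσ _) φ hφ) (x, 1) (y, γ s(x, y))
    ⟨hxy, by simp⟩
  simpa [σ] using this

/-- Arc consistency: `n` rounds in which a value is removed from the list of `x` if some
neighbour of `x` has no compatible value left. -/
def arcLists (G : LoopGraph U) (H : LoopGraph V) (L : U → Set V) : ℕ → U → Set V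
  | 0, x => L x
  | n + 1, x => {a | a ∈ G.arcLists H L n x ∧
      ∀ y, G.Adj x y → ∃ b ∈ G.arcLists H L n y, H.Adj a b}

theorem arcLists_subset {L : U → Set V} (n : ℕ) (x : U) : G.arcLists H L n x ⊆ L x := by
  induction n with
  | zero => exact subset_rfl
  | succ n ih => exact fun a ha => ih ha.1

/-- The sequence of edges `w`, read from its end, is a walk from `o` to `y`. -/
def IsTrail (G : LoopGraph U) (o : U) : List (Sym2 U) → U → Prop
  | [], y => y = o
  | e :: w, y => ∃ z, G.Adj z y ∧ s(z, y) = e ∧ G.IsTrail o w z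

open Classical in
/-- Values along the walks that start in a fixed vertex, chosen step by step from the lists
obtained by arc consistency, the list used after `i` steps being that of round `n - i`. -/
noncomputable def treeValue (G : LoopGraph U) (H : LoopGraph V) (L : U → Set V) (n : ℕ) (a : V) :
    List (Sym2 U) → U → V
  | [], _ => a
  | e :: w, y =>
    if h : ∃ b, ∃ z, G.Adj z y ∧ s(z, y) = e ∧ b ∈ G.arcLists H L (n - (w.length + 1)) y ∧
        H.Adj (G.treeValue H L n a w z) b then h.choose else a

theorem treeValue_mem_and_adj {L : U → Set V} {n : ℕ} {a : V} {o : U}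
    (ha : a ∈ G.arcLists H L n o) {w : List (Sym2 U)} {y : U} (hw : G.IsTrail o w y)
    (hn : w.length ≤ n) :
    G.treeValue H L n a w y ∈ G.arcLists H L (n - w.length) y ∧
      ∀ z, G.Adj y z → w.length < n →
        G.treeValue H L n a (s(y, z) :: w) z ∈ G.arcLists H L (n - (w.length + 1)) z ∧
        H.Adj (G.treeValue H L n a w y) (G.treeValue H L n a (s(y, z) :: w) z) := by
  have key : ∀ {w : List (Sym2 U)} {y : U},
      G.treeValue H L n a w y ∈ G.arcLists H L (n - w.length) y →
      ∀ z, G.Adj y z → w.length < n →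
        G.treeValue H L n a (s(y, z) :: w) z ∈ G.arcLists H L (n - (w.length + 1)) z ∧
        H.Adj (G.treeValue H L n a w y) (G.treeValue H L n a (s(y, z) :: w) z) := by
    intro w y hy z hyz hlt
    rw [show n - w.length = n - (w.length + 1) + 1 by omega] at hy
    obtain ⟨b, hb, hab⟩ := hy.2 z hyz
    have hex : ∃ b, ∃ x, G.Adj x z ∧ s(x, z) = s(y, z) ∧
        b ∈ G.arcLists H L (n - (w.length + 1)) z ∧ H.Adj (G.treeValue H L n a w x) b :=
      ⟨b, y, hyz, rfl, hb, hab⟩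
    obtain ⟨x, _, hx, h1, h2⟩ := hex.choose_spec
    obtain rfl := Sym2.congr_left.1 hx
    rw [treeValue, dif_pos hex]
    exact ⟨h1, h2⟩
  refine (fun h => ⟨h, key h⟩) ?_
  induction w generalizing y with
  | nil =>
    rw [show y = o from hw]
    exact ha
  | cons e w ih =>
    obtain ⟨z, hzy, rfl, hz⟩ := hw
    rw [List.length_cons] at hn ⊢
    exact (key (ih hz (by omega)) y hzy (by omega)).1

open Classical in
/-- Left multiplication of a reduced word over involutive letters by the letter `e`, except that
words of length `N` do not grow. -/
noncomputable def toggle {α : Type*} (N : ℕ) (e : α) : List α → List α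
  | [] => if 0 < N then [e] else []
  | b :: w => if e = b then w else if w.length + 1 < N then e :: b :: w else b :: w

theorem toggle_toggle {α : Type*} {N : ℕ} (e : α) {w : List α}
    (hw : w.IsChain (· ≠ ·)) (hN : w.length ≤ N) : toggle N e (toggle N e w) = w := by
  rcases w with _ | ⟨b, w⟩
  · by_cases h : 0 < N <;> simp [toggle, h]
  · by_cases hb : e = b
    · subst hb
      rcases w with _ | ⟨c, w⟩
      · have : 0 < N := hN
        simp [toggle, this]
      · have h1 : e ≠ c := (List.isChain_cons_cons.1 hw).1
        have h2 : w.length + 1 < N := by simpa using hN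
        simp [toggle, h1, h2]
    · by_cases h : w.length + 1 < N <;> simp [toggle, hb, h]

theorem toggle_isChain {α : Type*} {N : ℕ} (e : α) {w : List α}
    (hw : w.IsChain (· ≠ ·)) : (toggle N e w).IsChain (· ≠ ·) := by
  rcases w with _ | ⟨b, w⟩
  · by_cases h : 0 < N <;> simp [toggle, h]
  · by_cases hb : e = b
    · simpa [toggle, hb] using hw.tail
    · by_cases h : w.length + 1 < N
      · simpa [toggle, hb, h] using hw
      · simpa [toggle, hb, h] using hw

theorem length_toggle_le {α : Type*} {N : ℕ} (e : α) {w : List α}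
    (hN : w.length ≤ N) : (toggle N e w).length ≤ N := by
  rcases w with _ | ⟨b, w⟩
  · by_cases h : 0 < N
    · simpa [toggle, h] using Nat.succ_le_of_lt h
    · simp [toggle, h]
  · rw [List.length_cons] at hN
    simp only [toggle]
    split_ifs <;> (try simp only [List.length_cons]) <;> omega

theorem toggle_cases {α : Type*} {N : ℕ} (e : α) {w : List α}
    (hN : w.length < N) : w = e :: toggle N e w ∨ toggle N e w = e :: w := by
  rcases w with _ | ⟨b, w⟩
  · exact .inr (if_pos hN)
  · rw [List.length_cons] at hN
    by_cases hb : e = b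
    · simp [toggle, hb]
    · simp [toggle, hb, hN]

/-- Reduced words of length at most `N` over involutive letters. -/
abbrev ReducedWord (α : Type*) (N : ℕ) : Type _ :=
  {w : List α // w.IsChain (· ≠ ·) ∧ w.length ≤ N}

instance {α : Type*} [Finite α] (N : ℕ) : Finite (ReducedWord α N) :=
  ((List.finite_length_le α N).subset fun _ hw => hw.2).to_subtype

open Classical in
/-- The involution of the set of reduced words given by a letter. -/
noncomputable def togglePerm {α : Type*} (N : ℕ) (e : α) : Equiv.Perm (ReducedWord α N) :=
  Function.Involutive.toPerm
    (fun w => ⟨toggle N e w.1, toggle_isChain e w.2.1, length_toggle_le e w.2.2⟩)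
    fun w => Subtype.ext (toggle_toggle e w.2.1 w.2.2)

open Classical in
/-- If arc consistency leaves all lists nonempty for sufficiently many rounds, then there is a
list homomorphism. Small balls of the cover whose group is generated by the letters acting on
reduced words are trees, and a tree of small depth has a list homomorphism. -/
theorem exists_isSolOn_of_arcLists [Finite U] [Finite V] {m : ℕ} {F : ℕ → V → V → V}
    (hF : IsInterpolation H m F) {L : U → Set V} (hL : ListsClosed H F L)
    (hne : ∀ x, (G.arcLists H L (m + 1) x).Nonempty) : ∃ φ, IsSolOn G H L Set.univ φ := by
  have hγ : ∀ e : Sym2 U, togglePerm (m + 2) e * togglePerm (m + 2) e = 1 := fun e =>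
    Equiv.ext fun w => Subtype.ext (toggle_toggle e w.2.1 w.2.2)
  have hinv : ∀ e : Sym2 U, (togglePerm (m + 2) e)⁻¹ = togglePerm (m + 2) e := fun e =>
    inv_eq_of_mul_eq_one_left (hγ e)
  refine exists_isSolOn_of_cover (γ := togglePerm (m + 2)) (hγ := hγ) hF hL
    (exists_isSolOn_of_local hF (fun z => hL z.1) ?_)
  rintro ⟨o, g₀⟩
  obtain ⟨a, ha⟩ := hne o
  -- the word that leads from `(o, g₀)` to `z`
  let word : U × Equiv.Perm (ReducedWord (Sym2 U) (m + 2)) → List (Sym2 U) :=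
    fun z => ((z.2⁻¹ * g₀) ⟨[], by simp⟩).1
  have hword : ∀ {x y}, (G.cover (togglePerm (m + 2)) hγ).Adj x y →
      word y = toggle (m + 2) s(x.1, y.1) (word x) := by
    rintro x y ⟨-, h⟩
    simp only [word]
    rw [h, mul_inv_rev, hinv, mul_assoc]
    rfl
  have hball : ∀ i, i ≤ m + 1 →
      ∀ z ∈ (G.cover (togglePerm (m + 2)) hγ).ball Set.univ (o, g₀) i,
      (word z).length ≤ i ∧ G.IsTrail o (word z) z.1 := by
    intro i
    induction i with
    | zero =>
      rintro - z (rfl : z = _)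
      simp [word, IsTrail]
    | succ i ih =>
      rintro hi z (hz | ⟨-, y, hy, hyz⟩)
      · have := ih (by omega) z hz
        exact ⟨by omega, this.2⟩
      · obtain ⟨h1, h2⟩ := ih (by omega) y hy
        rcases toggle_cases (N := m + 2) s(y.1, z.1) (w := word y) (by omega) with h | h
        · rw [← hword hyz] at h
          rw [h] at h1 h2
          obtain ⟨x, _, hx, hx'⟩ := h2
          rw [Sym2.eq_swap] at hx
          rw [Sym2.congr_right.1 hx] at hx'
          rw [List.length_cons] at h1
          exact ⟨by omega, hx'⟩
        · rw [hword hyz, h, List.length_cons]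
          exact ⟨by omega, y.1, hyz.1, rfl, h2⟩
  refine ⟨fun z => G.treeValue H L (m + 1) a (word z) z.1, fun x hx y hy hxy => ?_,
    fun x hx => ?_⟩
  · obtain ⟨hx1, hx2⟩ := hball _ le_rfl x hx
    obtain ⟨hy1, hy2⟩ := hball _ le_rfl y hy
    rcases toggle_cases (N := m + 2) s(x.1, y.1) (w := word x) (by omega) with h | h
    · rw [← hword hxy, Sym2.eq_swap] at h
      rw [h, List.length_cons] at hx1
      have := ((treeValue_mem_and_adj ha hy2 hy1).2 x.1 (G.symm _ _ hxy.1) (by omega)).2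
      rw [← h] at this
      exact H.symm _ _ this
    · rw [← hword hxy] at h
      rw [h, List.length_cons] at hy1
      have := ((treeValue_mem_and_adj ha hx2 hx1).2 y.1 hxy.1 (by omega)).2
      rwa [← h] at this
  · obtain ⟨hx1, hx2⟩ := hball _ le_rfl x hx
    exact arcLists_subset _ _ (treeValue_mem_and_adj ha hx2 hx1).1

/-! ### From interpolations to near unanimity -/

open Classical in
/-- The vertex `a` is joined by even walks to more than half of the entries of `x`. -/
def IsMajority (H : LoopGraph V) {k : ℕ} (x : Fin k → V) (a : V) : Prop :=
  k < 2 * (Finset.univ.filter fun i => H.EvenReachable a (x i)).card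

open Classical in
theorem IsMajority.mono {k : ℕ} {x y : Fin k → V} {a b : V}
    (h : ∀ i, H.EvenReachable a (x i) → H.EvenReachable b (y i)) (ha : H.IsMajority x a) :
    H.IsMajority y b :=
  lt_of_lt_of_le ha (Nat.mul_le_mul_left 2 (Finset.card_le_card
    (Finset.monotone_filter_right _ fun i _ => h i)))

theorem IsMajority.congr {k : ℕ} {x : Fin k → V} {a b : V} (hab : H.EvenReachable a b)
    (ha : H.IsMajority x a) : H.IsMajority x b :=
  ha.mono fun _ h => hab.symm.trans h

theorem IsMajority.step {k : ℕ} {x y : Fin k → V} {a b : V} (hxy : ∀ i, H.Adj (x i) (y i))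
    (hab : H.Adj a b) (ha : H.IsMajority x a) : H.IsMajority y b :=
  ha.mono fun i h => h.step hab (hxy i)

open Classical in
theorem IsMajority.evenReachable {k : ℕ} {x : Fin k → V} {a b : V} (ha : H.IsMajority x a)
    (hb : H.IsMajority x b) : H.EvenReachable a b := by
  obtain ⟨i, hi⟩ : ((Finset.univ.filter fun i => H.EvenReachable a (x i)) ∩
      Finset.univ.filter fun i => H.EvenReachable b (x i)).Nonempty := by
    refine Finset.inter_nonempty_of_card_lt_card_add_card (Finset.subset_univ _)
      (Finset.subset_univ _) ?_
    unfold IsMajority at ha hb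
    rw [Finset.card_univ, Fintype.card_fin]
    omega
  simp only [Finset.mem_inter, Finset.mem_filter, Finset.mem_univ, true_and] at hi
  exact hi.1.trans hi.2.symm

open Classical in
/-- There are at most two classes of vertices joined by even walks, so among an odd number of
entries one class has the majority. -/
theorem lt_card_isMajority (hH : H.Connected) {k : ℕ} (hk : Odd k) (x : Fin k → V) :
    k < 2 * (Finset.univ.filter fun j => H.IsMajority x (x j)).card := by
  have key : ∀ j, H.IsMajority x (x j) →
      k < 2 * (Finset.univ.filter fun j => H.IsMajority x (x j)).card := fun j hj =>
    lt_of_lt_of_le hj (Nat.mul_le_mul_left 2 (Finset.card_le_card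
      (Finset.monotone_filter_right _ fun i _ h => hj.congr h)))
  let o : Fin k := ⟨0, hk.pos⟩
  by_cases ho : H.IsMajority x (x o)
  · exact key o ho
  have hcard := Finset.card_filter_add_card_filter_not (s := (Finset.univ : Finset (Fin k)))
    (fun i => H.EvenReachable (x o) (x i))
  rw [Finset.card_univ, Fintype.card_fin] at hcard
  unfold IsMajority at ho
  obtain ⟨c, hc⟩ := hk
  have hlt : k < 2 * (Finset.univ.filter fun i => ¬ H.EvenReachable (x o) (x i)).card := by
    omega
  obtain ⟨j, hj⟩ : (Finset.univ.filter fun i => ¬ H.EvenReachable (x o) (x i)).Nonempty := by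
    rw [← Finset.card_pos]
    omega
  simp only [Finset.mem_filter, Finset.mem_univ, true_and] at hj
  exact key j (lt_of_lt_of_le hlt (Nat.mul_le_mul_left 2 (Finset.card_le_card
    (Finset.monotone_filter_right _ fun i _ h =>
      evenReachable_of_not hH (fun h' => hj h'.symm) h))))

/-- The values that a near unanimity operation may take at `x`: members of the majority class,
and only `a` if at most one entry differs from `a`. -/
def nuLists (H : LoopGraph V) (k : ℕ) (x : Fin k → V) : Set V :=
  {v | H.IsMajority x v ∧ ∀ a j, (∀ i, i ≠ j → x i = a) → v = a}

theorem nuLists_closed (hN : ∀ x, ∃ y, H.Adj x y) {m : ℕ} {F : ℕ → V → V → V}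
    (hF : IsInterpolation H m F) (k : ℕ) : ListsClosed H F (H.nuLists k) := by
  intro x v hv w hw
  have he := hv.1.evenReachable hw.1
  refine ⟨he, fun i => ⟨hv.1.congr (hF.evenReachable hN i he), fun a j h => ?_⟩⟩
  rw [hv.2 a j h, hw.2 a j h, hF.diag]

open Classical in
/-- Arc consistency only removes boundedly many of the entries `x j` in the majority class from
the list of `x`: if the value `v` is removed because of a neighbour `y v` of `x`, then for each `j`
with `x j = v` the entry `y v j` has been removed from the list of `y v`. -/
theorem card_removed_le [Fintype V] {k : ℕ} (hk : 3 ≤ k) (n : ℕ) (x : Fin k → V) :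
    (Finset.univ.filter fun j => H.IsMajority x (x j) ∧
      x j ∉ (H.power k).arcLists H (H.nuLists k) n x).card ≤ (1 + Fintype.card V) ^ n := by
  induction n generalizing x with
  | zero =>
    rw [pow_zero, Finset.card_le_one]
    have key : ∀ j, H.IsMajority x (x j) ∧ x j ∉ H.nuLists k x →
        ∃ a, (∀ i, i ≠ j → x i = a) ∧ x j ≠ a := by
      rintro j ⟨h1, h2⟩
      have h3 : ¬ ∀ a j', (∀ i, i ≠ j' → x i = a) → x j = a := fun h => h2 ⟨h1, h⟩
      push Not at h3
      obtain ⟨a, j', h4, h5⟩ := h3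
      obtain rfl : j = j' := by
        by_contra h
        exact h5 (h4 j h)
      exact ⟨a, h4, h5⟩
    intro j hj j' hj'
    obtain ⟨a, h1, h2⟩ := key j (Finset.mem_filter.1 hj).2
    obtain ⟨a', h1', h2'⟩ := key j' (Finset.mem_filter.1 hj').2
    by_contra hne
    -- a third index shows that both unanimous values agree
    obtain ⟨i, hi⟩ : ∃ i, i ∉ ({j, j'} : Finset (Fin k)) := by
      by_contra! h
      have h3 := Finset.card_le_card (fun i _ => h i : Finset.univ ⊆ ({j, j'} : Finset (Fin k)))
      have h4 := Finset.card_le_two (a := j) (b := j')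
      rw [Finset.card_univ, Fintype.card_fin] at h3
      omega
    simp only [Finset.mem_insert, Finset.mem_singleton, not_or] at hi
    have : a = a' := (h1 i hi.1).symm.trans (h1' i hi.2)
    exact h2 (this ▸ h1' j hne)
  | succ n ih =>
    let bad : (Fin k → V) → Finset (Fin k) := fun x => Finset.univ.filter fun j =>
      H.IsMajority x (x j) ∧ x j ∉ (H.power k).arcLists H (H.nuLists k) n x
    have hy : ∀ v, ∃ y, (∃ y, (H.power k).Adj x y ∧
        ∀ b ∈ (H.power k).arcLists H (H.nuLists k) n y, ¬ H.Adj v b) →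
        (H.power k).Adj x y ∧ ∀ b ∈ (H.power k).arcLists H (H.nuLists k) n y, ¬ H.Adj v b := by
      intro v
      by_cases h : ∃ y, (H.power k).Adj x y ∧
        ∀ b ∈ (H.power k).arcLists H (H.nuLists k) n y, ¬ H.Adj v b
      · obtain ⟨y, hy⟩ := h
        exact ⟨y, fun _ => hy⟩
      · exact ⟨x, fun h' => absurd h' h⟩
    choose y hy using hy
    have hsub : (Finset.univ.filter fun j => H.IsMajority x (x j) ∧
        x j ∉ (H.power k).arcLists H (H.nuLists k) (n + 1) x) ⊆
        bad x ∪ Finset.univ.biUnion fun v => bad (y v) := by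
      intro j hj
      obtain ⟨h1, h2⟩ := (Finset.mem_filter.1 hj).2
      rw [Finset.mem_union]
      by_cases h3 : x j ∈ (H.power k).arcLists H (H.nuLists k) n x
      · right
        have h4 : ¬ ∀ z, (H.power k).Adj x z →
            ∃ b ∈ (H.power k).arcLists H (H.nuLists k) n z, H.Adj (x j) b :=
          fun h => h2 ⟨h3, h⟩
        push Not at h4
        obtain ⟨h5, h6⟩ := hy (x j) h4
        exact Finset.mem_biUnion.2 ⟨x j, Finset.mem_univ _, Finset.mem_filter.2
          ⟨Finset.mem_univ _, h1.step h5 (h5 j), fun h => h6 _ h (h5 j)⟩⟩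
      · exact .inl (Finset.mem_filter.2 ⟨Finset.mem_univ _, h1, h3⟩)
    calc _ ≤ (bad x ∪ Finset.univ.biUnion fun v => bad (y v)).card := Finset.card_le_card hsub
      _ ≤ (bad x).card + (Finset.univ.biUnion fun v => bad (y v)).card :=
        Finset.card_union_le _ _
      _ ≤ (1 + Fintype.card V) ^ n + Fintype.card V * (1 + Fintype.card V) ^ n :=
        Nat.add_le_add (ih x) (Finset.card_biUnion_le_card_mul _ _ _ fun v _ => ih (y v))
      _ = (1 + Fintype.card V) ^ (n + 1) := by ring

open Classical in
theorem IsInterpolation.hasNUPolymorphism [Finite V] (hH : H.Connected)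
    (hN : ∀ x, ∃ y, H.Adj x y) {m : ℕ} {F : ℕ → V → V → V} (hF : IsInterpolation H m F) :
    H.HasNUPolymorphism := by
  have := Fintype.ofFinite V
  obtain ⟨B, hB⟩ : ∃ B, B = (1 + Fintype.card V) ^ (m + 1) := ⟨_, rfl⟩
  have hB1 : 1 ≤ B := by rw [hB]; exact Nat.one_le_pow _ _ (by omega)
  have hne : ∀ x,
      ((H.power (2 * B + 1)).arcLists H (H.nuLists (2 * B + 1)) (m + 1) x).Nonempty := by
    intro x
    by_contra h
    rw [Set.not_nonempty_iff_eq_empty] at h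
    have h1 := card_removed_le (H := H) (by omega) (m + 1) x
    have h2 := lt_card_isMajority hH ⟨B, rfl⟩ x
    rw [h] at h1
    simp only [Set.mem_empty_iff_false, not_false_eq_true, and_true] at h1
    omega
  obtain ⟨φ, hφ1, hφ2⟩ := exists_isSolOn_of_arcLists hF (nuLists_closed hN hF _) hne
  exact ⟨2 * B + 1, ⟨φ, fun {x y} h => hφ1 x trivial y trivial h⟩, by omega,
    fun x a j h => (hφ2 x trivial).2 a j h⟩

/-! ### Graphs with one vertex -/

theorem hasNUPolymorphism_of_subsingleton [Subsingleton V] : H.HasNUPolymorphism :=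
  ⟨3, ⟨fun x => x 0, fun h => h 0⟩, le_rfl, fun _ _ _ _ => Subsingleton.elim _ _⟩

theorem extTrivial_of_subsingleton [Subsingleton V] : H.ExtTrivial := by
  intro U _ G _ S p φ ψ
  obtain rfl : φ = ψ := Subtype.ext (RelHom.ext fun _ => Subsingleton.elim _ _)
  exact Relation.ReflTransGen.refl

theorem bipartiteExtTrivial_of_subsingleton [Subsingleton V] (h : ∀ x, ¬ H.Adj x x) :
    H.BipartiteExtTrivial := by
  refine ⟨⟨fun _ => true, fun x y hxy => ?_⟩, fun cH _ U _ G _ cG _ S p _ φ ψ => ?_⟩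
  · exact absurd (Subsingleton.elim y x ▸ hxy) (h x)
  · obtain rfl : φ = ψ := Subtype.ext (RelHom.ext fun _ => Subsingleton.elim _ _)
    exact Relation.ReflTransGen.refl

theorem dismantles_diagonal_of_subsingleton [Subsingleton V] :
    (H.prod H).Dismantles H.diagonalComponent (diagonal V) := by
  have : H.diagonalComponent = diagonal V := Set.Subset.antisymm
    (fun z _ => Subsingleton.elim z.1 z.2) fun z hz => ⟨z, hz, Relation.ReflTransGen.refl⟩
  rw [this]
  exact Relation.ReflTransGen.refl

end LoopGraph


theorem theorem3p1 {V : Type u} [Finite V] (H : LoopGraph V) (hH : H.Connected) :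
    List.TFAE [
      H.HasNUPolymorphism,
      (H.prod H).Dismantles H.diagonalComponent (LoopGraph.diagonal V),
      H.ExtTrivial ∨ H.BipartiteExtTrivial] ∧
    ((∃ x y, H.Adj x y) →
      (H.ExtTrivial ↔ H.HasNUPolymorphism ∧ ∃ x, H.Adj x x)) ∧
    ((∀ x, ¬ H.Adj x x) →
      (H.BipartiteExtTrivial ↔ H.HasNUPolymorphism)) := by
  rcases subsingleton_or_nontrivial V with _ | _
  · refine ⟨?_, ?_, ?_⟩
    · have h1 := LoopGraph.hasNUPolymorphism_of_subsingleton (H := H)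
      have h2 := LoopGraph.dismantles_diagonal_of_subsingleton (H := H)
      have h3 := LoopGraph.extTrivial_of_subsingleton (H := H)
      tfae_have 1 → 2 := fun _ => h2
      tfae_have 2 → 3 := fun _ => .inl h3
      tfae_have 3 → 1 := fun _ => h1
      tfae_finish
    · rintro ⟨x, y, hxy⟩
      exact ⟨fun _ => ⟨LoopGraph.hasNUPolymorphism_of_subsingleton, x,
        Subsingleton.elim y x ▸ hxy⟩, fun _ => LoopGraph.extTrivial_of_subsingleton⟩
    · exact fun h => ⟨fun _ => LoopGraph.hasNUPolymorphism_of_subsingleton,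
        fun _ => LoopGraph.bipartiteExtTrivial_of_subsingleton h⟩
  have hN := LoopGraph.exists_adj_of_connected hH
  have h13 : H.HasNUPolymorphism → H.ExtTrivial ∨ H.BipartiteExtTrivial := fun h =>
    let ⟨_, _, hF⟩ := h.exists_isInterpolation hN
    hF.extTrivial_or hH hN
  have hE : H.ExtTrivial → H.HasNUPolymorphism := fun h =>
    let ⟨_, _, hF⟩ := h.exists_isInterpolation hH hN
    hF.hasNUPolymorphism hH hN
  have hB : H.BipartiteExtTrivial → H.HasNUPolymorphism := fun h =>
    let ⟨_, _, hF⟩ := h.exists_isInterpolation hH hN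
    hF.hasNUPolymorphism hH hN
  refine ⟨?_, ?_, ?_⟩
  · tfae_have 1 → 3 := h13
    tfae_have 3 → 1 := fun h => h.elim hE hB
    tfae_have 1 → 2 := fun h =>
      let ⟨_, _, hF⟩ := h.exists_isInterpolation hN
      hF.dismantles hN
    tfae_have 2 → 1 := fun h =>
      let ⟨_, _, hF⟩ := LoopGraph.exists_isInterpolation_of_dismantles hN h
      hF.hasNUPolymorphism hH hN
    tfae_finish
  · rintro ⟨x, y, hxy⟩
    refine ⟨fun h => ⟨hE h, h.exists_loop hN (hE h) hxy⟩, ?_⟩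
    rintro ⟨h, z, hz⟩
    refine (h13 h).resolve_right ?_
    rintro ⟨⟨c, hc⟩, -⟩
    exact hc z z hz rfl
  · intro hirr
    refine ⟨hB, fun h => (h13 h).resolve_left fun hext => ?_⟩
    obtain ⟨x⟩ := hH.1
    obtain ⟨y, hxy⟩ := hN x
    obtain ⟨z, hz⟩ := hext.exists_loop hN h hxy
    exact hirr z hz
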